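/- Let $A$ be an abelian group isomorphic to $\mathbb{Z}^n$ for some $n\in\mathbb{N}$, let $R=\mathbb{Z}[A]$ be its group ring and let $\mathbb{F}=\mathrm{Quot}(R)$ be the field of fractions of $R$. For a path-connected and locally contractible pointed space $(X,x_0)$ and a homomorphism $\alpha:\pi_1(X,x_0)\to A$, let $\tilde X\to X$ be the $\alpha$-cover, that is, the (not necessarily connected) regular covering with group of deck transformations $A$ whose monodromy is $\alpha$, and let $$\mathcal{H}^\alpha_i(X)=H_i\bigl(C_*(\tilde X)\otimes_R\mathbb{F}\bigr),\qquad i\in\mathbb{N}_0,$$ be the $\alpha$-twisted homology, where $C_*(\tilde X)$ is the singular chain complex of $\tilde X$, regarded as a complex of $R$-modules through the action of $A$ on $\tilde X$. A pointed map $f:X\to Y$ and a homomorphism $\alpha:\pi_1(Y)\to A$ induce $\mathbb{F}$-linear maps $\mathcal{H}^{\alpha\circ\pi_1(f)}_i(X)\to\mathcal{H}^\alpha_i(Y)$. Let $S^1\vee S^1$ be the wedge of two circles, with the wedge point as base point, and suppose that the homomorphism $\alpha:\pi_1(S^1\vee S^1)\to A$ is nontrivial. Then, as $\mathbb{F}$-vector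 spaces, $$\mathcal{H}^\alpha_i(S^1\vee S^1)\cong\begin{cases}\mathbb{F}&\text{if } i=1,\\ 0&\text{if } i\in\mathbb{N}_0,\ i\neq 1.\end{cases}$$ Moreover, if the restriction $\alpha\circ\pi_1(\iota_j)$ of $\alpha$ along the inclusion $\iota_j:S^1\to S^1\vee S^1$ of one of the two wedge factors ($j\in\{1,2\}$) is trivial, then $\iota_j$ induces an isomorphism $\mathcal{H}^{\alpha\circ\pi_1(\iota_j)}_1(S^1)\to\mathcal{H}^\alpha_1(S^1\vee S^1)$. -/

import Mathlib

noncomputable section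

open CategoryTheory Topology
open scoped unitInterval

/-! ### The `α`-cover of a pointed space -/

section Cover

variable {X Y : Type} [TopologicalSpace X] [TopologicalSpace Y] {A : Type} [CommGroup A]

/-- The space of paths in `X` that start at `x₀` and end anywhere, with the compact-open topology. -/
abbrev BasedPath (X : Type) [TopologicalSpace X] (x₀ : X) : Type :=
  {γ : C(I, X) // γ 0 = x₀}

/-- `(γ, a)` and `(γ', a')` define the same point of the `α`-cover if `γ` and `γ'` have the same
endpoint `y` and `a' = α [γ · γ'⁻¹] * a`. Here `(γ, a)` stands for the endpoint of the lift of `γ`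
that starts at the point `a` of the fibre `A` over `x₀`. -/
def AlphaCover.Rel {x₀ : X} (α : FundamentalGroup X x₀ →* A) (s t : BasedPath X x₀ × A) : Prop :=
  ∃ (y : X) (p q : Path x₀ y), p.toContinuousMap = s.1.1 ∧ q.toContinuousMap = t.1.1 ∧
    t.2 = α (FundamentalGroup.fromPath (Path.Homotopic.Quotient.mk (p.trans q.symm))) * s.2

theorem AlphaCover.rel_equivalence {x₀ : X} (α : FundamentalGroup X x₀ →* A) :
    Equivalence (AlphaCover.Rel α) where
  refl s := by
    refine ⟨s.1.1 1, ⟨s.1.1, s.1.2, rfl⟩, ⟨s.1.1, s.1.2, rfl⟩, rfl, rfl, ?_⟩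
    rw [Path.Homotopic.Quotient.mk_trans, Path.Homotopic.Quotient.mk_symm,
      Path.Homotopic.Quotient.trans_symm]
    have h : α (FundamentalGroup.fromPath (Path.Homotopic.Quotient.refl x₀)) = 1 := map_one α
    rw [h, one_mul]
  symm := by
    rintro s t ⟨y, p, q, hp, hq, h⟩
    refine ⟨y, q, p, hq, hp, ?_⟩
    have e : (FundamentalGroup.fromPath (Path.Homotopic.Quotient.mk (q.trans p.symm)) :
        FundamentalGroup X x₀) =
        (FundamentalGroup.fromPath (Path.Homotopic.Quotient.mk (p.trans q.symm)))⁻¹ := by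
      rw [FundamentalGroup.inv_def]
      change _ = (Path.Homotopic.Quotient.mk (p.trans q.symm)).symm
      rw [← Path.Homotopic.Quotient.mk_symm, Path.trans_symm, Path.symm_symm]
    rw [h, e, map_inv, inv_mul_cancel_left]
  trans := by
    rintro s t u ⟨y, p, q, hp, hq, h⟩ ⟨z, q', r, hq', hr, h'⟩
    have hyz : y = z := by
      rw [← q.target, ← q'.target]
      change q.toContinuousMap 1 = q'.toContinuousMap 1
      rw [hq, hq']
    subst hyz
    have hqq : q' = q := by
      ext i
      change q'.toContinuousMap i = q.toContinuousMap i
      rw [hq, hq']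
    subst hqq
    refine ⟨y, p, r, hp, hr, ?_⟩
    have e : (FundamentalGroup.fromPath (Path.Homotopic.Quotient.mk (p.trans r.symm)) :
        FundamentalGroup X x₀) =
        FundamentalGroup.fromPath (Path.Homotopic.Quotient.mk (q'.trans r.symm)) *
        FundamentalGroup.fromPath (Path.Homotopic.Quotient.mk (p.trans q'.symm)) := by
      rw [FundamentalGroup.mul_def]
      simp only [Path.Homotopic.Quotient.mk_trans, Path.Homotopic.Quotient.mk_symm]
      rw [Path.Homotopic.Quotient.trans_assoc, ← Path.Homotopic.Quotient.trans_assoc _ _ (Path.Homotopic.Quotient.mk r).symm,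
        Path.Homotopic.Quotient.symm_trans, Path.Homotopic.Quotient.refl_trans]
    rw [h', h, e, map_mul, mul_assoc]

/-- The relation `AlphaCover.Rel`, as a setoid. -/
def AlphaCover.setoid {x₀ : X} (α : FundamentalGroup X x₀ →* A) : Setoid (BasedPath X x₀ × A) :=
  ⟨AlphaCover.Rel α, AlphaCover.rel_equivalence α⟩

/-- The `α`-cover `X̃` of a pointed space `(X, x₀)`, for a homomorphism `α : π₁(X, x₀) → A`:
pairs of a path from `x₀` and an element of `A`, modulo the identification `AlphaCover.Rel`.
For `α` the trivial homomorphism and `X` path connected and locally path connected it is `A × X`. -/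
def AlphaCover {x₀ : X} (α : FundamentalGroup X x₀ →* A) : Type :=
  Quotient (AlphaCover.setoid α)

/-- The quotient topology, where paths carry the compact-open and `A` the discrete topology. -/
instance {x₀ : X} (α : FundamentalGroup X x₀ →* A) : TopologicalSpace (AlphaCover α) :=
  letI : TopologicalSpace A := ⊥
  inferInstanceAs (TopologicalSpace (Quotient (AlphaCover.setoid α)))

/-- The covering projection `X̃ → X`, `[γ, a] ↦ γ 1`. -/
def AlphaCover.proj {x₀ : X} (α : FundamentalGroup X x₀ →* A) : AlphaCover α → X :=
  Quotient.lift (fun s => s.1.1 1) (by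
    rintro s t ⟨y, p, q, hp, hq, -⟩
    rw [← hp, ← hq]
    exact p.target.trans q.target.symm)

theorem AlphaCover.rel_smul {x₀ : X} {α : FundamentalGroup X x₀ →* A} (b : A)
    {s t : BasedPath X x₀ × A} (h : AlphaCover.Rel α s t) :
    AlphaCover.Rel α (s.1, b * s.2) (t.1, b * t.2) := by
  obtain ⟨y, p, q, hp, hq, h⟩ := h
  exact ⟨y, p, q, hp, hq, by rw [h, mul_left_comm]⟩

/-- The group `A` acts on the `α`-cover by the deck transformations `b • [γ, a] = [γ, b * a]`. -/
instance {x₀ : X} (α : FundamentalGroup X x₀ →* A) : MulAction A (AlphaCover α) where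
  smul b := Quotient.map (fun s => (s.1, b * s.2)) (fun _ _ h => AlphaCover.rel_smul b h)
  one_smul := by
    rintro ⟨γ, a⟩
    exact congrArg (fun c => Quotient.mk (AlphaCover.setoid α) (γ, c)) (one_mul a)
  mul_smul := by
    rintro b c ⟨γ, a⟩
    exact congrArg (fun d => Quotient.mk (AlphaCover.setoid α) (γ, d)) (mul_assoc b c a)

instance {x₀ : X} (α : FundamentalGroup X x₀ →* A) : ContinuousConstSMul A (AlphaCover α) where
  continuous_const_smul b := by
    let _ : TopologicalSpace A := ⊥
    have : DiscreteTopology A := ⟨rfl⟩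
    exact Continuous.quotient_map' (f := fun s : BasedPath X x₀ × A => (s.1, b * s.2))
      (by fun_prop) (fun _ _ h => AlphaCover.rel_smul b h)

/-- Composition of a path from `x₀` with a pointed map. -/
def BasedPath.map (f : C(X, Y)) {x₀ : X} {y₀ : Y} (hf : f x₀ = y₀) (γ : BasedPath X x₀) :
    BasedPath Y y₀ :=
  ⟨f.comp γ.1, by rw [ContinuousMap.comp_apply, γ.2, hf]⟩

theorem AlphaCover.rel_map (f : C(X, Y)) {x₀ : X} {y₀ : Y} (hf : f x₀ = y₀)
    (α : FundamentalGroup Y y₀ →* A) {s t : BasedPath X x₀ × A}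
    (h : AlphaCover.Rel (α.comp (FundamentalGroup.mapOfEq f hf)) s t) :
    AlphaCover.Rel α (s.1.map f hf, s.2) (t.1.map f hf, t.2) := by
  subst hf
  obtain ⟨y, p, q, hp, hq, h⟩ := h
  refine ⟨f y, p.map f.continuous, q.map f.continuous, ?_, ?_, ?_⟩
  · change _ = f.comp s.1.1
    rw [← hp]; rfl
  · change _ = f.comp t.1.1
    rw [← hq]; rfl
  · rw [h, MonoidHom.comp_apply, FundamentalGroup.mapOfEq_apply,
      Path.Homotopic.Quotient.cast_rfl_rfl, ← Path.Homotopic.Quotient.mk_map, Path.map_trans,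
      Path.map_symm]

/-- A pointed map `f : (X, x₀) → (Y, y₀)` lifts to an `A`-equivariant continuous map from the
`(α ∘ π₁(f))`-cover of `X` to the `α`-cover of `Y`, namely `[γ, a] ↦ [f ∘ γ, a]`. -/
def AlphaCover.map (f : C(X, Y)) {x₀ : X} {y₀ : Y} (hf : f x₀ = y₀)
    (α : FundamentalGroup Y y₀ →* A) :
    C(AlphaCover (α.comp (FundamentalGroup.mapOfEq f hf)), AlphaCover α) where
  toFun := Quotient.map (fun s => (s.1.map f hf, s.2)) (fun _ _ h => AlphaCover.rel_map f hf α h)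
  continuous_toFun := by
    let _ : TopologicalSpace A := ⊥
    refine Continuous.quotient_map' (f := fun s : BasedPath X x₀ × A => (s.1.map f hf, s.2)) ?_
      (fun _ _ h => AlphaCover.rel_map f hf α h)
    refine Continuous.prodMk (Continuous.subtype_mk ?_ _) continuous_snd
    exact (ContinuousMap.continuous_postcomp f).comp (continuous_subtype_val.comp continuous_fst)

theorem AlphaCover.map_smul (f : C(X, Y)) {x₀ : X} {y₀ : Y} (hf : f x₀ = y₀)
    (α : FundamentalGroup Y y₀ →* A) (b : A)
    (e : AlphaCover (α.comp (FundamentalGroup.mapOfEq f hf))) :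
    AlphaCover.map f hf α (b • e) = b • AlphaCover.map f hf α e := by
  obtain ⟨γ, a⟩ := e
  rfl

end Cover

/-! ### Singular chains of a space with an action of `A`, as a complex of `ℤ[A]`-modules -/

section Chains

variable (A : Type) [CommGroup A]

/-- The free abelian group on an `A`-set, as a representation of `A` over `ℤ`. -/
def freeRep (S : Type) [MulAction A S] : Representation ℤ A (S →₀ ℤ) where
  toFun a := Finsupp.lmapDomain ℤ ℤ (a • ·)
  map_one' := by ext; simp
  map_mul' a b := by ext; simp [mul_smul]

/-- The free abelian group on an `A`-set, as a module over the group ring `ℤ[A]`. -/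
def freeModule (S : Type) [MulAction A S] : ModuleCat.{0} (MonoidAlgebra ℤ A) :=
  ModuleCat.of (MonoidAlgebra ℤ A) (freeRep A S).asModule

variable {A} in
/-- The `ℤ[A]`-linear map induced by an `A`-equivariant map. -/
def freeModuleMap {S T : Type} [MulAction A S] [MulAction A T] (f : S →[A] T) :
    freeModule A S ⟶ freeModule A T :=
  ModuleCat.ofHom (Representation.IntertwiningMap.equivLinearMapAsModule _ _
    (LinearMap.intertwiningMap_of_isIntertwiningMap (freeRep A S) (freeRep A T)
      (Finsupp.lmapDomain ℤ ℤ f) (fun g v => by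
        change Finsupp.mapDomain f (Finsupp.mapDomain (g • ·) v) =
          Finsupp.mapDomain (g • ·) (Finsupp.mapDomain f v)
        rw [← Finsupp.mapDomain_comp, ← Finsupp.mapDomain_comp]
        congr 1
        funext s
        exact map_smul f g s)))

theorem freeModuleMap_apply {S T : Type} [MulAction A S] [MulAction A T] (f : S →[A] T)
    (v : S →₀ ℤ) : (freeModuleMap f).hom v = Finsupp.mapDomain f v := rfl

theorem freeModuleMap_id (S : Type) [MulAction A S] :
    freeModuleMap (MulActionHom.id A : S →[A] S) = 𝟙 (freeModule A S) := by
  refine ModuleCat.hom_ext (LinearMap.ext fun v => ?_)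
  exact (freeModuleMap_apply A _ v).trans Finsupp.mapDomain_id

theorem freeModuleMap_comp {S T U : Type} [MulAction A S] [MulAction A T] [MulAction A U]
    (f : S →[A] T) (g : T →[A] U) :
    freeModuleMap f ≫ freeModuleMap g = freeModuleMap (g.comp f) := by
  refine ModuleCat.hom_ext (LinearMap.ext fun v => ?_)
  exact (Finsupp.mapDomain_comp (f := f) (g := g) (v := v)).symm

variable (E E' : Type) [TopologicalSpace E] [MulAction A E] [ContinuousConstSMul A E]
  [TopologicalSpace E'] [MulAction A E'] [ContinuousConstSMul A E']

/-- The singular `n`-simplices of `E`, on which `A` acts pointwise. -/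
abbrev SingularSimplex (n : SimplexCategory) : Type :=
  C(stdSimplex ℝ (Fin (n.len + 1)), E)

/-- Precomposition of singular simplices with the affine map of standard simplices that a monotone
map of vertices induces. -/
def singularPrecomp {m n : SimplexCategory} (g : m ⟶ n) :
    SingularSimplex E n →[A] SingularSimplex E m where
  toFun τ := τ.comp ⟨stdSimplex.map g, stdSimplex.continuous_map g⟩
  map_smul' _ _ := rfl

/-- The simplicial `ℤ[A]`-module `n ↦ ℤ{singular n-simplices of E}`. -/
def singularModule : SimplicialObject (ModuleCat.{0} (MonoidAlgebra ℤ A)) where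
  obj n := freeModule A (SingularSimplex E n.unop)
  map g := freeModuleMap (singularPrecomp A E g.unop)
  map_id n := by
    rw [← freeModuleMap_id]
    congr 1
    ext τ t
    exact congrArg τ (stdSimplex.map_id_apply t)
  map_comp f g := by
    rw [freeModuleMap_comp]
    congr 1
    ext τ t
    exact congrArg τ (stdSimplex.map_comp_apply g.unop f.unop t).symm

/-- The singular chain complex `C_*(E)`, with the alternating sum of the faces as differential,
as a complex of `ℤ[A]`-modules. -/
def singularChains : ChainComplex (ModuleCat.{0} (MonoidAlgebra ℤ A)) ℕ :=
  (AlgebraicTopology.alternatingFaceMapComplex _).obj (singularModule A E)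

variable {A E E'}

/-- Composition of singular simplices with an `A`-equivariant continuous map. -/
def singularPostcomp (f : C(E, E')) (hf : ∀ (a : A) (e : E), f (a • e) = a • f e)
    (n : SimplexCategory) : SingularSimplex E n →[A] SingularSimplex E' n where
  toFun τ := f.comp τ
  map_smul' a τ := ContinuousMap.ext fun t => hf a (τ t)

/-- The map of simplicial `ℤ[A]`-modules induced by an `A`-equivariant continuous map. -/
def singularModuleMap (f : C(E, E')) (hf : ∀ (a : A) (e : E), f (a • e) = a • f e) :
    singularModule A E ⟶ singularModule A E' where
  app n := freeModuleMap (singularPostcomp f hf n.unop)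
  naturality m n g := by
    change freeModuleMap (singularPrecomp A E g.unop) ≫
        freeModuleMap (singularPostcomp f hf n.unop) =
      freeModuleMap (singularPostcomp f hf m.unop) ≫ freeModuleMap (singularPrecomp A E' g.unop)
    rw [freeModuleMap_comp, freeModuleMap_comp]
    congr 1

/-- The chain map induced by an `A`-equivariant continuous map. -/
def singularChainsMap (f : C(E, E')) (hf : ∀ (a : A) (e : E), f (a • e) = a • f e) :
    singularChains A E ⟶ singularChains A E' :=
  (AlgebraicTopology.alternatingFaceMapComplex _).map (singularModuleMap f hf)

end Chains

/-! ### Twisted homology -/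

section TwistedHomology

variable {X Y : Type} [TopologicalSpace X] [TopologicalSpace Y] {A : Type} [CommGroup A]

/-- `𝔽 = Quot(ℤ[A])`; it is a field when `A` is free abelian of finite rank. -/
abbrev QuotGroupRing (A : Type) [CommGroup A] : Type := FractionRing (MonoidAlgebra ℤ A)

/-- The functor `C ↦ 𝔽 ⊗_{ℤ[A]} C` from complexes of `ℤ[A]`-modules to complexes of
`𝔽`-modules. -/
def tensorQuot (A : Type) [CommGroup A] :
    ChainComplex (ModuleCat.{0} (MonoidAlgebra ℤ A)) ℕ ⥤
      ChainComplex (ModuleCat.{0} (QuotGroupRing A)) ℕ :=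
  haveI : (ModuleCat.extendScalars.{0, 0, 0}
      (algebraMap (MonoidAlgebra ℤ A) (QuotGroupRing A))).PreservesZeroMorphisms :=
    inferInstance
  (ModuleCat.extendScalars (algebraMap (MonoidAlgebra ℤ A)
    (QuotGroupRing A))).mapHomologicalComplex (ComplexShape.down ℕ)

/-- The twisted homology `H_i^α(X) = H_i(C_*(X̃) ⊗_{ℤ[A]} 𝔽)`, where `X̃` is the `α`-cover. -/
def twistedHomology {x₀ : X} (α : FundamentalGroup X x₀ →* A) (i : ℕ) :
    ModuleCat.{0} (QuotGroupRing A) :=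
  ((tensorQuot A).obj (singularChains A (AlphaCover α))).homology i

/-- The map `H_i^{α ∘ π₁(f)}(X) → H_i^α(Y)` induced by a pointed map `f : (X, x₀) → (Y, y₀)`. -/
def twistedHomologyMap (f : C(X, Y)) {x₀ : X} {y₀ : Y} (hf : f x₀ = y₀)
    (α : FundamentalGroup Y y₀ →* A) (i : ℕ) :
    twistedHomology (α.comp (FundamentalGroup.mapOfEq f hf)) i ⟶ twistedHomology α i :=
  HomologicalComplex.homologyMap
    ((tensorQuot A).map (singularChainsMap (AlphaCover.map f hf α) (AlphaCover.map_smul f hf α))) i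

end TwistedHomology

/-! ### The wedge of two circles -/

/-- The wedge `S¹ ∨ S¹`: two copies of the unit circle, with their points `1` identified. -/
def CircleWedge : Type :=
  Quot (fun a b : Circle ⊕ Circle => a = Sum.inl 1 ∧ b = Sum.inr 1)

instance : TopologicalSpace CircleWedge :=
  inferInstanceAs (TopologicalSpace (Quot _))

namespace CircleWedge

/-- The inclusion of the first circle. -/
def incl₁ : C(Circle, CircleWedge) :=
  ⟨fun z => Quot.mk _ (Sum.inl z), continuous_quot_mk.comp continuous_inl⟩

/-- The inclusion of the second circle. -/
def incl₂ : C(Circle, CircleWedge) :=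
  ⟨fun z => Quot.mk _ (Sum.inr z), continuous_quot_mk.comp continuous_inr⟩

/-- The wedge point. -/
def base : CircleWedge := incl₁ 1

theorem incl₁_one : incl₁ 1 = base := rfl

theorem incl₂_one : incl₂ 1 = base := (Quot.sound ⟨rfl, rfl⟩).symm

end CircleWedge

end

/-!
A wedge of circles `X` has a contractible covering `T`, the Cayley tree of a free group `F`, whose
group of deck transformations is `F`. The twisted homology of `X` is computed from `T`, and no
excision theorem is needed.

Let `ι` be the set of free generators of `F`, let `K` be the fraction field of `ℤ[A]`, let `S` be
the set of singular `n`-simplices of `T`, and let `ρ : F → A` be the homomorphism that corresponds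
to `α` (`ContractibleCovering.deckHom`). There is a map from `T` to the `α`-cover `X̃` of `X` which
is `ρ`-equivariant (`ContractibleCovering.toAlphaCover`), and every singular simplex of `X̃` is a
translate of the image of a singular simplex of `T`, which is unique up to the action of `F`
(`ContractibleCovering.exists_lift`, `ContractibleCovering.lift_unique`). Hence the `n`-chains
`K ⊗ ℤ[singular simplices of X̃]` are the quotient of `K[S]` by the relations `g • s = ρ g * s`. It
is enough to impose them for the free generators of `F`, and since `F` acts freely on `S` these
relations are independent, as Fox derivatives show. So there is a short exact sequence
`0 → K[ι × S] → K[S] → K ⊗ ℤ[singular simplices of X̃] → 0`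
(`ContractibleCovering.shortExact`), compatible with the face maps.

The first two chain complexes have homology only in degree `0`, namely `K[ι]` and `K`, because
coning off simplices with the contraction of `T` is an extra degeneracy
(`SingularCone.extraDegeneracy`). The map between these homology groups is `e ↦ 1 - ρ e`. By the long
exact sequence, `H₁` and `H₀` of `X` are the kernel and the cokernel of this map, and the higher
homology vanishes. If `α` is nontrivial, the map is surjective, so that `H₀ = 0` and `H₁` has
dimension `|ι| - 1`.

If `α` is trivial on a wedge of all circles but one, then `H₁` of this subspace is the whole vector
space generated by its circles; by naturality of the connecting homomorphism
(`ContractibleCovering.Hom.connecting_naturality`) it maps injectively to `H₁` of the whole wedge,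
and the dimensions are equal.
-/

noncomputable section

open CategoryTheory Topology
open scoped unitInterval

/-! ### The tree of a free group -/

namespace FreeGroup

variable {ι : Type} [DecidableEq ι]

theorem norm_mk_singleton_mul (w : FreeGroup ι) (l : ι × Bool) :
    (mk [l] * w).norm = w.norm + 1 ∨ w.norm = (mk [l] * w).norm + 1 := by
  have h : (mk [l] * w).toWord = reduce (l :: w.toWord) := by
    conv_lhs => rw [← mk_toWord (x := w)]
    rw [mul_mk, toWord_mk, List.singleton_append]
  unfold norm
  rw [h, reduce.cons, reduce_toWord]
  cases hw : w.toWord with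
  | nil => left; rfl
  | cons y t =>
    dsimp only
    split_ifs
    · right; simp
    · left; simp

theorem norm_mul_mk_singleton (w : FreeGroup ι) (l : ι × Bool) :
    (w * mk [l]).norm = w.norm + 1 ∨ w.norm = (w * mk [l]).norm + 1 := by
  have h := norm_mk_singleton_mul w⁻¹ (l.1, !l.2)
  have e : mk [(l.1, !l.2)] * w⁻¹ = (w * mk [l])⁻¹ := by
    rw [mul_inv_rev, inv_mk]; rfl
  rwa [e, norm_inv_eq, norm_inv_eq] at h

/-- A nontrivial element is obtained from a shorter one by appending a letter. -/
theorem exists_eq_mul_mk_singleton {w : FreeGroup ι} (hw : w ≠ 1) :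
    ∃ (v : FreeGroup ι) (l : ι × Bool), w = v * mk [l] ∧ w.norm = v.norm + 1 := by
  obtain h | ⟨L, l, h⟩ := List.eq_nil_or_concat w.toWord
  · exact absurd (toWord_eq_nil_iff.1 h) hw
  · have e : w = mk L * mk [l] := by
      rw [mul_mk, ← List.concat_eq_append, ← h, mk_toWord]
    refine ⟨mk L, l, e, ?_⟩
    have h₁ : w.norm = L.length + 1 := by simp [norm, h]
    have h₂ : (mk L).norm ≤ L.length := norm_mk_le
    obtain h₃ | h₃ := norm_mul_mk_singleton (mk L) l
    · rw [e, h₃]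
    · rw [e] at h₁; omega

theorem mk_singleton_false {α : Type*} (e : α) : mk [(e, false)] = (of e)⁻¹ := by
  rw [of, inv_mk]; rfl

theorem of_mul_of_ne_one (a b : ι) : of a * of b ≠ 1 := by
  intro h
  have := congrArg toWord h
  simp [toWord_mul] at this

end FreeGroup

namespace CayleyTree

variable {ι : Type} [DecidableEq ι]

/-- Real functions on the set of edges of the Cayley graph of the free group on `ι`. The pair
`(g, e)` stands for the edge from `g` to `g * e`. The topology is that of pointwise convergence. -/
abbrev EdgeSpace (ι : Type) : Type := FreeGroup ι × ι → ℝ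

/-- The affine transformation of the space of functions on edges by which the generator `a` acts:
translation of the edges by `a`, followed by addition of the edge from `1` to `a`. -/
def generatorPerm (a : ι) : Equiv.Perm (EdgeSpace ι) where
  toFun f x := (Pi.single (1, a) 1 : EdgeSpace ι) x + f ((FreeGroup.of a)⁻¹ * x.1, x.2)
  invFun f x := f (FreeGroup.of a * x.1, x.2) -
    (Pi.single (1, a) 1 : EdgeSpace ι) (FreeGroup.of a * x.1, x.2)
  left_inv f := by ext x; simp
  right_inv f := by ext x; simp

/-- The affine action of the free group on the functions on edges. Under it, `0` moves to the
function that counts, with signs, how often a path from `1` to `g` runs through each edge. -/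
instance : MulAction (FreeGroup ι) (EdgeSpace ι) :=
  MulAction.compHom _ (FreeGroup.lift generatorPerm)

theorem of_smul_apply (a : ι) (f : EdgeSpace ι) (x : FreeGroup ι × ι) :
    (FreeGroup.of a • f) x =
      (Pi.single (1, a) 1 : EdgeSpace ι) x + f ((FreeGroup.of a)⁻¹ * x.1, x.2) := by
  change (FreeGroup.lift generatorPerm (FreeGroup.of a)) f x = _
  rw [FreeGroup.lift_apply_of]
  rfl

/-- The linear part of the affine action is the translation of edges. -/
theorem smul_apply (g : FreeGroup ι) (f : EdgeSpace ι) (x : FreeGroup ι × ι) :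
    (g • f) x = (g • (0 : EdgeSpace ι)) x + f (g⁻¹ * x.1, x.2) := by
  have hinv : ∀ g : FreeGroup ι, (∀ (f : EdgeSpace ι) (x : FreeGroup ι × ι),
      (g • f) x = (g • (0 : EdgeSpace ι)) x + f (g⁻¹ * x.1, x.2)) →
      ∀ (f : EdgeSpace ι) (x : FreeGroup ι × ι),
      (g⁻¹ • f) x = f (g * x.1, x.2) - (g • (0 : EdgeSpace ι)) (g * x.1, x.2) := by
    intro g h f x
    have := h (g⁻¹ • f) (g * x.1, x.2)
    rw [smul_inv_smul] at this
    simp only [inv_mul_cancel_left] at this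
    rw [this]; simp
  induction g using FreeGroup.induction_on generalizing f x with
  | C1 => simp
  | of a => rw [of_smul_apply, of_smul_apply]; simp
  | inv_of a h => rw [hinv _ h, hinv _ h 0]; simp; ring
  | mul g h hg hh =>
    rw [mul_smul, mul_smul, hg, hh, hg (h • 0)]
    simp [mul_assoc, add_assoc]

instance : ContinuousConstSMul (FreeGroup ι) (EdgeSpace ι) where
  continuous_const_smul g := by
    refine continuous_pi fun x => ?_
    have : (fun f : EdgeSpace ι => (g • f) x) =
        fun f => (g • (0 : EdgeSpace ι)) x + f (g⁻¹ * x.1, x.2) := funext fun f => smul_apply g f x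
    rw [this]
    fun_prop

/-- The point at distance `t` from `g` on the edge from `g` to `g * e`. -/
def edgePoint (g : FreeGroup ι) (e : ι) (t : ℝ) : EdgeSpace ι :=
  g • (Pi.single (1, e) t : EdgeSpace ι)

/-- The vertex `g`. -/
def vertex (g : FreeGroup ι) : EdgeSpace ι := g • (0 : EdgeSpace ι)

theorem smul_edgePoint (g h : FreeGroup ι) (e : ι) (t : ℝ) :
    g • edgePoint h e t = edgePoint (g * h) e t := (mul_smul _ _ _).symm

theorem vertex_one : vertex (1 : FreeGroup ι) = 0 := one_smul _ _

theorem edgePoint_zero (g : FreeGroup ι) (e : ι) : edgePoint g e 0 = vertex g := by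
  rw [edgePoint, Pi.single_zero, vertex]

theorem edgePoint_eq (g : FreeGroup ι) (e : ι) (t : ℝ) :
    edgePoint g e t = vertex g + Pi.single (g, e) t := by
  ext x
  rw [edgePoint, smul_apply, Pi.add_apply, vertex]
  congr 1
  simp only [Pi.single_apply, Prod.ext_iff]
  simp only [inv_mul_eq_one, eq_comm]

theorem edgePoint_one (g : FreeGroup ι) (e : ι) :
    edgePoint g e 1 = vertex (g * FreeGroup.of e) := by
  rw [edgePoint, vertex, mul_smul]
  congr 1
  ext x
  rw [of_smul_apply]
  simp

theorem continuous_edgePoint (g : FreeGroup ι) (e : ι) : Continuous (edgePoint g e) :=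
  (continuous_const_smul g).comp (continuous_single (A := fun _ : FreeGroup ι × ι => ℝ) (1, e))

/-! ### Barycentric coordinates -/

variable [Fintype ι]

/-- The barycentric coordinate of a point of the tree at the vertex `w`. -/
def coord (w : FreeGroup ι) (f : EdgeSpace ι) : ℝ :=
  (if w = 1 then 1 else 0) + ∑ e : ι, (f (w * (FreeGroup.of e)⁻¹, e) - f (w, e))

theorem continuous_coord (w : FreeGroup ι) : Continuous (coord w) := by
  unfold coord
  fun_prop

theorem coord_smul (g w : FreeGroup ι) (f : EdgeSpace ι) :
    coord w (g • f) = coord (g⁻¹ * w) f := by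
  induction g using FreeGroup.induction_on generalizing w f with
  | C1 => simp
  | of a =>
    simp only [coord, of_smul_apply, Pi.single_apply, Prod.ext_iff]
    have h : ∀ e : ι, ((if w * (FreeGroup.of e)⁻¹ = 1 ∧ e = a then (1 : ℝ) else 0) +
        f ((FreeGroup.of a)⁻¹ * (w * (FreeGroup.of e)⁻¹), e) -
        ((if w = 1 ∧ e = a then 1 else 0) + f ((FreeGroup.of a)⁻¹ * w, e))) =
        (if e = a then ((if w = FreeGroup.of a then (1 : ℝ) else 0) - if w = 1 then 1 else 0)
          else 0) + (f ((FreeGroup.of a)⁻¹ * w * (FreeGroup.of e)⁻¹, e) -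
            f ((FreeGroup.of a)⁻¹ * w, e)) := by
      intro e
      rw [← mul_assoc]
      by_cases he : e = a
      · subst he
        simp only [and_true, mul_inv_eq_one, if_true]
        ring
      · simp [he]
    simp only [h, Finset.sum_add_distrib, Finset.sum_ite_eq', Finset.mem_univ, if_true,
      inv_mul_eq_one, eq_comm (a := FreeGroup.of a)]
    ring
  | inv_of a h =>
    have := h (FreeGroup.of a * w) ((FreeGroup.of a)⁻¹ • f)
    rw [smul_inv_smul, inv_mul_cancel_left] at this
    rw [← this, inv_inv]
  | mul g h hg hh => rw [mul_smul, hg, hh, mul_inv_rev, mul_assoc]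

theorem coord_edgePoint (w g : FreeGroup ι) (e : ι) (t : ℝ) :
    coord w (edgePoint g e t) =
      (if w = g then 1 - t else 0) + if w = g * FreeGroup.of e then t else 0 := by
  rw [edgePoint, coord_smul]
  have key : ∀ v : FreeGroup ι, coord v (Pi.single (1, e) t) =
      (if v = 1 then 1 - t else 0) + if v = FreeGroup.of e then t else 0 := by
    intro v
    simp only [coord, Pi.single_apply, Prod.ext_iff]
    have h : ∀ e' : ι, ((if v * (FreeGroup.of e')⁻¹ = 1 ∧ e' = e then t else 0) -
        if v = 1 ∧ e' = e then t else 0) =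
        if e' = e then ((if v = FreeGroup.of e then t else 0) - if v = 1 then t else 0) else 0 := by
      intro e'
      by_cases he : e' = e
      · subst he; simp [mul_inv_eq_one]
      · simp [he]
    simp only [h, Finset.sum_ite_eq', Finset.mem_univ, if_true]
    split_ifs <;> ring
  rw [key]
  simp only [inv_mul_eq_iff_eq_mul, mul_one]

theorem coord_vertex (w g : FreeGroup ι) : coord w (vertex g) = if w = g then 1 else 0 := by
  rw [vertex, coord_smul]
  simp [coord, inv_mul_eq_one, eq_comm]

/-- An interior point of an edge determines the edge and its position on it. -/
theorem edgePoint_injective {g g' : FreeGroup ι} {e e' : ι} {t t' : ℝ} (h₀ : 0 < t) (h₁ : t < 1)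
    (h : edgePoint g e t = edgePoint g' e' t') : g = g' ∧ e = e' ∧ t = t' := by
  have hne : ∀ (x : FreeGroup ι) (a : ι), x ≠ x * FreeGroup.of a := fun x a hx =>
    FreeGroup.of_ne_one a (mul_eq_left.1 hx.symm)
  have c : ∀ w, _ := fun w => congrArg (coord w) h
  simp only [coord_edgePoint] at c
  have c₁ := c g
  have c₂ := c (g * FreeGroup.of e)
  rw [if_pos rfl, if_neg (hne _ _)] at c₁
  rw [if_neg (hne _ _).symm, if_pos rfl] at c₂
  by_cases hg : g = g'
  · subst hg
    rw [if_pos rfl, if_neg (hne _ _)] at c₁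
    rw [if_neg (hne _ _).symm] at c₂
    have ht : t = t' := by linarith
    refine ⟨rfl, ?_, ht⟩
    by_contra he
    rw [if_neg (fun h => he (FreeGroup.of_injective (mul_left_cancel h)))] at c₂
    linarith
  · exfalso
    rw [if_neg hg] at c₁
    by_cases h₂ : g = g' * FreeGroup.of e'
    · rw [if_neg (fun h => ?_), if_neg (fun h => ?_)] at c₂
      · linarith
      · rw [h₂] at h
        exact FreeGroup.of_ne_one e (mul_eq_left.1 h)
      · rw [h₂, mul_assoc] at h
        exact FreeGroup.of_mul_of_ne_one e' e (mul_eq_left.1 h)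
    · rw [if_neg h₂] at c₁
      linarith

end CayleyTree

/-! ### The contraction of the tree -/

namespace CayleyTree

variable {ι : Type} [DecidableEq ι]

/-- The distance of an edge from the root `1`. -/
def depth (x : FreeGroup ι × ι) : ℕ := min x.1.norm (x.1 * FreeGroup.of x.2).norm

/-- The piecewise linear function on `[0, 1]` which increases from `0` to `1` on
`[1 - 2⁻ᵈ, 1 - 2⁻ᵈ⁻¹]`: these intervals are disjoint for different `d`. -/
def ramp (d : ℕ) (s : ℝ) : ℝ := max 0 (min 1 (2 ^ (d + 1) * (s - 1) + 2))

theorem ramp_nonneg (d : ℕ) (s : ℝ) : 0 ≤ ramp d s := le_max_left _ _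

theorem continuous_ramp (d : ℕ) : Continuous (ramp d) := by unfold ramp; fun_prop

theorem ramp_zero (d : ℕ) : ramp d 0 = 0 := by
  have : (2 : ℝ) ≤ 2 ^ (d + 1) := by
    rw [pow_succ]; nlinarith [one_le_pow₀ (M₀ := ℝ) (a := 2) (n := d) (by norm_num)]
  exact max_eq_left ((min_le_right _ _).trans (by linarith))

theorem ramp_one (d : ℕ) : ramp d 1 = 1 := by norm_num [ramp]

/-- As long as the contraction has not reached depth `d`, it does not affect smaller depths. -/
theorem ramp_eq_one {d k : ℕ} {s : ℝ} (hk : k < d) (h : 0 < ramp d s) (hs : s ≤ 1) :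
    ramp k s = 1 := by
  have h₁ : 0 < 2 ^ (d + 1) * (s - 1) + 2 := by
    by_contra! hc
    exact h.ne' (max_eq_left ((min_le_right _ _).trans hc))
  have h₂ : (2 : ℝ) ^ (k + 2) ≤ 2 ^ (d + 1) := pow_le_pow_right₀ (by norm_num) (by omega)
  have h₃ : 0 ≤ 2 ^ (k + 2) * (s - 1) + 2 := by nlinarith
  have h₄ : 1 ≤ 2 ^ (k + 1) * (s - 1) + 2 := by
    have : (2 : ℝ) ^ (k + 2) = 2 * 2 ^ (k + 1) := by ring
    rw [this] at h₃; linarith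
  rw [ramp, min_eq_left h₄, max_eq_right zero_le_one]

/-- Truncation of a function on edges, by a bound that decreases with the depth of the edge. On a
point of the tree it has the effect of moving this point towards the root along the geodesic. -/
def contract (s : ℝ) (f : EdgeSpace ι) : EdgeSpace ι :=
  fun x => max (-ramp (depth x) s) (min (ramp (depth x) s) (f x))

theorem contract_apply_of_eq_zero (s : ℝ) {f : EdgeSpace ι} {x : FreeGroup ι × ι} (h : f x = 0) :
    contract s f x = 0 := by
  simp [contract, h, ramp_nonneg]

theorem contract_apply_of_ramp_eq_zero {s : ℝ} (f : EdgeSpace ι) {x : FreeGroup ι × ι}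
    (h : ramp (depth x) s = 0) : contract s f x = 0 := by
  simp [contract, h]

theorem contract_apply_of_ramp_eq_one {s : ℝ} {f : EdgeSpace ι} {x : FreeGroup ι × ι}
    (h : ramp (depth x) s = 1) (hf : |f x| ≤ 1) : contract s f x = f x := by
  rw [contract, h, min_eq_right (abs_le.1 hf).2, max_eq_right (abs_le.1 hf).1]

variable (ι) in
/-- The Cayley tree of the free group on `ι`, realized as the union of the edges
`{edgePoint g e t | 0 ≤ t ≤ 1}` in the space of functions on the set of edges: the point `x` becomes
the function which measures, with signs, how much of each edge the geodesic from `1` to `x` covers.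
-/
def carrier : Set (EdgeSpace ι) := {f | ∃ g e, ∃ t ∈ I, f = edgePoint g e t}

theorem edgePoint_mem (g : FreeGroup ι) (e : ι) {t : ℝ} (ht : t ∈ I) : edgePoint g e t ∈ carrier ι :=
  ⟨g, e, t, ht, rfl⟩

/-- The unit vector by which one leaves the vertex `w` in the direction of the letter `l`. -/
def direction (w : FreeGroup ι) : ι × Bool → EdgeSpace ι
  | (e, true) => Pi.single (w, e) 1
  | (e, false) => -Pi.single (w * (FreeGroup.of e)⁻¹, e) 1

theorem vertex_mul_mk_singleton (w : FreeGroup ι) (l : ι × Bool) :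
    vertex (w * FreeGroup.mk [l]) = vertex w + direction w l := by
  obtain ⟨e, b⟩ := l
  cases b
  · have h := edgePoint_one (w * (FreeGroup.of e)⁻¹) e
    rw [edgePoint_eq, inv_mul_cancel_right] at h
    rw [FreeGroup.mk_singleton_false, direction, ← h, add_neg_cancel_right]
  · have h := edgePoint_one w e
    rw [edgePoint_eq] at h
    exact h.symm

theorem vertex_add_smul_direction_true (w : FreeGroup ι) (e : ι) (t : ℝ) :
    vertex w + t • direction w (e, true) = edgePoint w e t := by
  rw [edgePoint_eq, direction, ← Pi.single_smul, smul_eq_mul, mul_one]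

theorem vertex_add_smul_direction_false (w : FreeGroup ι) (e : ι) (t : ℝ) :
    vertex w + t • direction w (e, false) = edgePoint (w * (FreeGroup.of e)⁻¹) e (1 - t) := by
  have h := edgePoint_one (w * (FreeGroup.of e)⁻¹) e
  rw [inv_mul_cancel_right, edgePoint_eq] at h
  rw [edgePoint_eq, direction, ← h, smul_neg, ← Pi.single_smul, smul_eq_mul, mul_one,
    Pi.single_sub]
  abel

theorem vertex_add_smul_direction_mem (w : FreeGroup ι) (l : ι × Bool) {t : ℝ} (ht : t ∈ I) :
    vertex w + t • direction w l ∈ carrier ι := by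
  obtain ⟨e, b⟩ := l
  cases b
  · rw [vertex_add_smul_direction_false]
    exact edgePoint_mem _ _ ⟨by linarith [ht.2], by linarith [ht.1]⟩
  · rw [vertex_add_smul_direction_true]
    exact edgePoint_mem _ _ ht

/-- Every point of the tree lies on an edge which leads away from the root. -/
theorem exists_eq_vertex_add {f : EdgeSpace ι} (hf : f ∈ carrier ι) :
    ∃ (w : FreeGroup ι) (l : ι × Bool), ∃ t ∈ I,
      (w * FreeGroup.mk [l]).norm = w.norm + 1 ∧ f = vertex w + t • direction w l := by
  obtain ⟨g, e, t, ht, rfl⟩ := hf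
  obtain h | h := FreeGroup.norm_mul_mk_singleton g (e, true)
  · exact ⟨g, (e, true), t, ht, h, (vertex_add_smul_direction_true _ _ _).symm⟩
  · refine ⟨g * FreeGroup.of e, (e, false), 1 - t, ⟨by linarith [ht.2], by linarith [ht.1]⟩, ?_, ?_⟩
    · rw [FreeGroup.mk_singleton_false, mul_inv_cancel_right]
      exact h
    · rw [vertex_add_smul_direction_false, mul_inv_cancel_right, sub_sub_cancel]

theorem exists_direction_eq {w : FreeGroup ι} {l : ι × Bool}
    (h : (w * FreeGroup.mk [l]).norm = w.norm + 1) :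
    ∃ x : FreeGroup ι × ι, depth x = w.norm ∧
      (direction w l = Pi.single x 1 ∨ direction w l = -Pi.single x 1) := by
  obtain ⟨e, b⟩ := l
  cases b
  · refine ⟨_, ?_, Or.inr rfl⟩
    rw [FreeGroup.mk_singleton_false] at h
    simp only [depth, inv_mul_cancel_right]
    omega
  · refine ⟨_, ?_, Or.inl rfl⟩
    change (w * FreeGroup.of e).norm = _ at h
    simp only [depth]
    omega

theorem abs_direction_apply_le (w : FreeGroup ι) (l : ι × Bool) (x : FreeGroup ι × ι) :
    |direction w l x| ≤ 1 := by
  obtain ⟨e, b⟩ := l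
  cases b <;> simp only [direction, Pi.neg_apply, abs_neg, Pi.single_apply] <;> split_ifs <;> simp

theorem direction_apply_of_depth_ne {w : FreeGroup ι} {l : ι × Bool}
    (h : (w * FreeGroup.mk [l]).norm = w.norm + 1) {x : FreeGroup ι × ι} (hx : depth x ≠ w.norm) :
    direction w l x = 0 := by
  obtain ⟨y, hy, h | h⟩ := exists_direction_eq h
  all_goals
    have : x ≠ y := fun e => hx (e ▸ hy)
    simp [h, this]

/-- The coordinates of a vertex `w` are at most `1` in absolute value, and vanish on all edges which
are not nearer to the root than `w`. -/
theorem vertex_apply (w : FreeGroup ι) (x : FreeGroup ι × ι) :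
    |vertex w x| ≤ 1 ∧ (w.norm ≤ depth x → vertex w x = 0) := by
  induction hn : w.norm using Nat.strong_induction_on generalizing w with
  | _ n ih =>
    by_cases hw : w = 1
    · subst hw
      simp [vertex_one]
    · obtain ⟨v, l, rfl, h⟩ := FreeGroup.exists_eq_mul_mk_singleton hw
      obtain ⟨h₁, h₂⟩ := ih v.norm (by omega) v rfl
      rw [vertex_mul_mk_singleton, Pi.add_apply]
      refine ⟨?_, fun hx => ?_⟩
      · by_cases hx : depth x = v.norm
        · rw [h₂ hx.ge, zero_add]
          exact abs_direction_apply_le _ _ _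
        · rwa [direction_apply_of_depth_ne h hx, add_zero]
      · rw [h₂ (by omega), direction_apply_of_depth_ne h (by omega), zero_add]

theorem clamp_smul_direction (w : FreeGroup ι) (l : ι × Bool) (x : FreeGroup ι × ι) {b t : ℝ}
    (hb : 0 ≤ b) (ht : 0 ≤ t) :
    max (-b) (min b (t * direction w l x)) = min t b * direction w l x := by
  have h : direction w l x = 0 ∨ direction w l x = 1 ∨ direction w l x = -1 := by
    obtain ⟨e, c⟩ := l
    cases c <;> simp only [direction, Pi.neg_apply, Pi.single_apply] <;> split_ifs <;> simp
  obtain h | h | h := h <;> rw [h]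
  · simp [hb]
  · rw [mul_one, mul_one, min_comm, max_eq_right]
    exact (neg_nonpos.2 hb).trans (le_min ht hb)
  · rw [mul_neg_one, mul_neg_one, min_eq_right (by linarith), max_neg_neg, min_comm]

/-- On an edge which leads away from `w`, the contraction moves points towards `w` at the times when
the bound for the depth of this edge is positive: the bounds for the smaller depths are then `1`. -/
theorem contract_vertex_add {w : FreeGroup ι} {l : ι × Bool}
    (h : (w * FreeGroup.mk [l]).norm = w.norm + 1) {s t : ℝ} (hs : s ≤ 1) (ht : 0 ≤ t)
    (hpos : 0 < ramp w.norm s) :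
    contract s (vertex w + t • direction w l) =
      vertex w + min t (ramp w.norm s) • direction w l := by
  ext x
  obtain ⟨h₁, h₂⟩ := vertex_apply w x
  obtain hx | hx | hx := lt_trichotomy (depth x) w.norm
  · have hd := direction_apply_of_depth_ne h hx.ne
    rw [contract_apply_of_ramp_eq_one (ramp_eq_one hx hpos hs)] <;> simp [hd, h₁]
  · simp only [contract, Pi.add_apply, Pi.smul_apply, smul_eq_mul, h₂ hx.ge, zero_add, hx]
    exact clamp_smul_direction w l x (ramp_nonneg _ _) ht
  · have hd := direction_apply_of_depth_ne h hx.ne'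
    rw [contract_apply_of_eq_zero] <;> simp [hd, h₂ hx.le]

/-- When the bound for the depth of an edge is `0`, the contraction has already moved the whole edge
to the image of its initial vertex. -/
theorem contract_vertex_add_of_ramp_eq_zero {w : FreeGroup ι} {l : ι × Bool}
    (h : (w * FreeGroup.mk [l]).norm = w.norm + 1) {s : ℝ} (t : ℝ) (hs : s ≤ 1)
    (hz : ramp w.norm s = 0) :
    contract s (vertex w + t • direction w l) = contract s (vertex w) := by
  ext x
  obtain hx | hx := lt_or_ge (depth x) w.norm
  · simp [contract, direction_apply_of_depth_ne h hx.ne]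
  · have : ramp (depth x) s = 0 := by
      obtain hx | hx := hx.eq_or_lt
      · rw [← hx, hz]
      · by_contra hne
        have := ramp_eq_one hx (lt_of_le_of_ne (ramp_nonneg _ _) (Ne.symm hne)) hs
        rw [hz] at this
        exact zero_ne_one this
    rw [contract_apply_of_ramp_eq_zero _ this, contract_apply_of_ramp_eq_zero _ this]

/-- The contraction maps vertices to points of the tree, by induction along the geodesic to the
root. -/
theorem contract_vertex_mem [Nonempty ι] (w : FreeGroup ι) {s : ℝ} (hs : s ≤ 1) :
    contract s (vertex w) ∈ carrier ι := by
  induction hn : w.norm using Nat.strong_induction_on generalizing w with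
  | _ n ih =>
    by_cases hw : w = 1
    · obtain ⟨e⟩ := ‹Nonempty ι›
      refine ⟨1, e, 0, ⟨le_rfl, zero_le_one⟩, ?_⟩
      rw [edgePoint_zero, hw, vertex_one]
      exact funext fun x => contract_apply_of_eq_zero s rfl
    · obtain ⟨v, l, rfl, h⟩ := FreeGroup.exists_eq_mul_mk_singleton hw
      obtain hz | hpos := (ramp_nonneg v.norm s).eq_or_lt
      · rw [vertex_mul_mk_singleton, ← one_smul ℝ (direction v l),
          contract_vertex_add_of_ramp_eq_zero h 1 hs hz.symm]
        exact ih v.norm (by omega) v rfl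
      · rw [vertex_mul_mk_singleton, ← one_smul ℝ (direction v l),
          contract_vertex_add h hs zero_le_one hpos]
        exact vertex_add_smul_direction_mem _ _ ⟨le_min zero_le_one hpos.le, min_le_left _ _⟩

theorem contract_mem [Nonempty ι] {f : EdgeSpace ι} (hf : f ∈ carrier ι) {s : ℝ} (hs : s ≤ 1) :
    contract s f ∈ carrier ι := by
  obtain ⟨w, l, t, ht, h, rfl⟩ := exists_eq_vertex_add hf
  obtain hz | hpos := (ramp_nonneg w.norm s).eq_or_lt
  · rw [contract_vertex_add_of_ramp_eq_zero h t hs hz.symm]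
    exact contract_vertex_mem _ hs
  · rw [contract_vertex_add h hs ht.1 hpos]
    exact vertex_add_smul_direction_mem _ _
      ⟨le_min ht.1 hpos.le, (min_le_left _ _).trans ht.2⟩

theorem contract_one {f : EdgeSpace ι} (hf : f ∈ carrier ι) : contract 1 f = f := by
  obtain ⟨w, l, t, ht, h, rfl⟩ := exists_eq_vertex_add hf
  rw [contract_vertex_add h le_rfl ht.1 (by simp [ramp_one]), ramp_one, min_eq_left ht.2]

theorem contract_zero (f : EdgeSpace ι) : contract 0 f = 0 :=
  funext fun _ => contract_apply_of_ramp_eq_zero f (ramp_zero _)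

theorem continuous_contract : Continuous fun p : ℝ × EdgeSpace ι => contract p.1 p.2 := by
  refine continuous_pi fun x => ?_
  have := continuous_ramp (depth x)
  unfold contract
  fun_prop

end CayleyTree

/-- A map `ι × [0, 1] → X` which exhibits `X` as a wedge of circles, one for each element of `ι`:
it is a quotient map, and it identifies all end points with each other and nothing else. -/
structure IsRose {ι X : Type} [TopologicalSpace ι] [TopologicalSpace X] (c : C(ι × I, X)) :
    Prop where
  isQuotientMap : IsQuotientMap c
  apply_eq_iff (x y : ι × I) :
    c x = c y ↔ x = y ∨ ((x.2 = 0 ∨ x.2 = 1) ∧ (y.2 = 0 ∨ y.2 = 1))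

namespace CayleyTree

variable {ι : Type} [DecidableEq ι]

/-! ### The tree as a covering space -/

theorem smul_mem (g : FreeGroup ι) {f : EdgeSpace ι} (hf : f ∈ carrier ι) : g • f ∈ carrier ι := by
  obtain ⟨h, e, t, ht, rfl⟩ := hf
  exact ⟨g * h, e, t, ht, smul_edgePoint g h e t⟩

end CayleyTree

/-- The Cayley tree of the free group on `ι`, as a topological space. -/
abbrev CayleyTree (ι : Type) [DecidableEq ι] : Type := CayleyTree.carrier ι

namespace CayleyTree

variable {ι : Type} [DecidableEq ι]

instance : MulAction (FreeGroup ι) (CayleyTree ι) where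
  smul g x := ⟨g • x.1, smul_mem g x.2⟩
  one_smul x := Subtype.ext (one_smul _ x.1)
  mul_smul g h x := Subtype.ext (mul_smul g h x.1)

theorem coe_smul (g : FreeGroup ι) (x : CayleyTree ι) :
    ((g • x : CayleyTree ι) : EdgeSpace ι) = g • (x : EdgeSpace ι) := rfl

instance : ContinuousConstSMul (FreeGroup ι) (CayleyTree ι) where
  continuous_const_smul g :=
    ((continuous_const_smul g).comp continuous_subtype_val).subtype_mk _

/-- The map from the disjoint union of all edges onto the tree. -/
def ofEdges (x : Σ _ : FreeGroup ι × ι, I) : CayleyTree ι :=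
  ⟨edgePoint x.1.1 x.1.2 x.2, edgePoint_mem _ _ x.2.2⟩

theorem smul_ofEdges (h g : FreeGroup ι) (e : ι) (t : I) :
    h • ofEdges ⟨(g, e), t⟩ = ofEdges ⟨(h * g, e), t⟩ := Subtype.ext (smul_edgePoint _ _ _ _)

theorem continuous_ofEdges : Continuous (ofEdges (ι := ι)) :=
  continuous_sigma fun x =>
    ((continuous_edgePoint x.1 x.2).comp continuous_subtype_val).subtype_mk _

theorem ofEdges_surjective : Function.Surjective (ofEdges (ι := ι)) := by
  rintro ⟨_, g, e, t, ht, rfl⟩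
  exact ⟨⟨(g, e), ⟨t, ht⟩⟩, rfl⟩

/-- The root of the tree. -/
def root [Nonempty ι] : CayleyTree ι :=
  ⟨0, 1, Classical.arbitrary ι, 0, ⟨le_rfl, zero_le_one⟩, by rw [edgePoint_zero, vertex_one]⟩

/-- The contraction of the tree to its root. -/
def homotopy [Nonempty ι] : C(I × CayleyTree ι, CayleyTree ι) where
  toFun x := ⟨contract x.1 x.2.1, contract_mem x.2.2 x.1.2.2⟩
  continuous_toFun := by
    refine Continuous.subtype_mk (f := fun x : I × CayleyTree ι => contract x.1 x.2.1) ?_ _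
    exact continuous_contract.comp (f := fun x : I × CayleyTree ι => ((x.1 : ℝ), x.2.1))
      (by fun_prop)

theorem homotopy_zero [Nonempty ι] (x : CayleyTree ι) : homotopy (0, x) = root :=
  Subtype.ext (contract_zero _)

theorem homotopy_one [Nonempty ι] (x : CayleyTree ι) : homotopy (1, x) = x :=
  Subtype.ext (contract_one x.2)

theorem ofEdges_zero (g : FreeGroup ι) (e e' : ι) : ofEdges ⟨(g, e), 0⟩ = ofEdges ⟨(g, e'), 0⟩ :=
  Subtype.ext ((edgePoint_zero _ _).trans (edgePoint_zero _ _).symm)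

theorem ofEdges_one (g : FreeGroup ι) (e e' : ι) :
    ofEdges ⟨(g, e), 1⟩ = ofEdges ⟨(g * FreeGroup.of e, e'), 0⟩ :=
  Subtype.ext ((edgePoint_one _ _).trans (edgePoint_zero _ _).symm)

theorem root_eq [Nonempty ι] (e : ι) : (root : CayleyTree ι) = ofEdges ⟨(1, e), 0⟩ :=
  Subtype.ext ((edgePoint_zero _ _).trans vertex_one).symm

variable [Fintype ι]

theorem exists_coord_pos {f : EdgeSpace ι} (hf : f ∈ carrier ι) : ∃ w, 0 < coord w f := by
  obtain ⟨g, e, t, ht, rfl⟩ := hf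
  by_cases h : t = 1
  · subst h
    exact ⟨g * FreeGroup.of e, by simp [edgePoint_one, coord_vertex]⟩
  · refine ⟨g, ?_⟩
    rw [coord_edgePoint, if_pos rfl, if_neg fun h => FreeGroup.of_ne_one e (mul_eq_left.1 h.symm)]
    linarith [lt_of_le_of_ne ht.2 h]

theorem eq_or_eq_of_coord_pos {w g : FreeGroup ι} {e : ι} {t : ℝ}
    (h : 0 < coord w (edgePoint g e t)) : w = g ∨ w = g * FreeGroup.of e := by
  by_contra! hc
  rw [coord_edgePoint, if_neg hc.1, if_neg hc.2, add_zero] at h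
  exact lt_irrefl _ h

/-- The tree carries the weak topology with respect to its edges. -/
theorem isQuotientMap_ofEdges : IsQuotientMap (ofEdges (ι := ι)) := by
  refine IsClosedMap.isQuotientMap (fun C hC => ?_) continuous_ofEdges ofEdges_surjective
  have hU : ofEdges '' C = ⋃ x : FreeGroup ι × ι, (fun t : I => ofEdges ⟨x, t⟩) '' {t | ⟨x, t⟩ ∈ C} := by
    ext y
    simp only [Set.mem_image, Set.mem_iUnion, Set.mem_ofPred_eq, Sigma.exists]
  rw [hU]
  refine LocallyFinite.isClosed_iUnion (fun y => ?_) fun x => ?_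
  · -- the open star of a vertex meets only the edges that start or end there
    obtain ⟨w, hw⟩ := exists_coord_pos y.2
    refine ⟨{z | 0 < coord w z.1}, (isOpen_lt continuous_const
      ((continuous_coord w).comp continuous_subtype_val)).mem_nhds hw, ?_⟩
    refine ((Set.finite_range fun e : ι => (w, e)).union
      (Set.finite_range fun e : ι => (w * (FreeGroup.of e)⁻¹, e))).subset ?_
    rintro ⟨g, e⟩ ⟨_, ⟨t, -, rfl⟩, hz⟩
    obtain h | h := eq_or_eq_of_coord_pos (show 0 < coord w (edgePoint g e t) from hz)
    · exact Or.inl ⟨e, by rw [h]⟩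
    · exact Or.inr ⟨e, by simp [h]⟩
  · have hcont : Continuous fun t : I => ofEdges (⟨x, t⟩ : Σ _ : FreeGroup ι × ι, I) :=
      continuous_ofEdges.comp continuous_sigmaMk
    exact ((hC.preimage continuous_sigmaMk).isCompact.image hcont).isClosed

theorem coord_sum_le {f : EdgeSpace ι} (hf : f ∈ carrier ι) {v w : FreeGroup ι} (h : v ≠ w) :
    coord v f + coord w f ≤ 1 := by
  obtain ⟨g, e, t, ht, rfl⟩ := hf
  rw [coord_edgePoint, coord_edgePoint]
  have h₀ := ht.1
  have h₁ := ht.2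
  split_ifs with h₁ h₂ h₃ h₄ <;> first | linarith | (exfalso; simp_all)

/-- Translates of a small neighbourhood of a point of the tree are disjoint. -/
theorem exists_nhds_disjoint (x : CayleyTree ι) :
    ∃ U ∈ 𝓝 x, ∀ g : FreeGroup ι, ((g • ·) '' U ∩ U).Nonempty → g = 1 := by
  have hopen : ∀ (w : FreeGroup ι) (r : ℝ), IsOpen {z : CayleyTree ι | r < coord w z.1} :=
    fun w r => isOpen_lt continuous_const ((continuous_coord w).comp continuous_subtype_val)
  obtain ⟨⟨⟨h, e⟩, t⟩, rfl⟩ := ofEdges_surjective x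
  have hne : h ≠ h * FreeGroup.of e := fun hx => FreeGroup.of_ne_one e (mul_eq_left.1 hx.symm)
  by_cases hv : ∃ w, 1 / 2 < coord w (edgePoint h e t)
  · obtain ⟨w, hw⟩ := hv
    refine ⟨_, (hopen w (1 / 2)).mem_nhds hw, ?_⟩
    rintro g ⟨_, ⟨y, hy, rfl⟩, hgy⟩
    simp only [Set.mem_ofPred_eq, coe_smul, coord_smul] at hy hgy
    by_contra hg
    have := coord_sum_le y.2 (v := w) (w := g⁻¹ * w) (by simpa using fun h => hg h)
    linarith
  · -- otherwise the point is the middle of an edge, and only two coordinates are positive near it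
    push Not at hv
    have h₁ := hv h
    have h₂ := hv (h * FreeGroup.of e)
    rw [coord_edgePoint, if_pos rfl, if_neg hne] at h₁
    rw [coord_edgePoint, if_neg hne.symm, if_pos rfl] at h₂
    refine ⟨_, ((hopen h 0).inter (hopen (h * FreeGroup.of e) 0)).mem_nhds ⟨?_, ?_⟩, ?_⟩
    · change 0 < coord h (edgePoint h e t)
      rw [coord_edgePoint, if_pos rfl, if_neg hne]; linarith
    · change 0 < coord (h * FreeGroup.of e) (edgePoint h e t)
      rw [coord_edgePoint, if_neg hne.symm, if_pos rfl]; linarith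
    · rintro g ⟨_, ⟨y, ⟨hy₁, hy₂⟩, rfl⟩, hgy₁, hgy₂⟩
      simp only [Set.mem_ofPred_eq, coe_smul, coord_smul] at hy₁ hy₂ hgy₁ hgy₂
      have hsupp : ∀ w, 0 < coord w y.1 → w = h ∨ w = h * FreeGroup.of e := by
        intro w hw
        obtain ⟨a, b, s, hs, hy⟩ := y.2
        rw [hy] at hw hy₁ hy₂
        have k := eq_or_eq_of_coord_pos hw
        have k₁ := eq_or_eq_of_coord_pos hy₁
        have k₂ := eq_or_eq_of_coord_pos hy₂
        grind
      have k₁ := hsupp _ hgy₁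
      have k₂ := hsupp _ hgy₂
      obtain k₁ | k₁ := k₁
      · simpa using k₁
      · rw [← mul_assoc, k₁] at k₂
        obtain k₂ | k₂ := k₂
        · rw [mul_assoc] at k₂
          exact absurd (mul_eq_left.1 k₂) (FreeGroup.of_mul_of_ne_one e e)
        · exact absurd (mul_eq_left.1 k₂) (FreeGroup.of_ne_one e)

/-! ### The projection to a wedge of circles -/

variable {X : Type} [TopologicalSpace ι] [TopologicalSpace X] {c : C(ι × I, X)}

theorem apply_eq_of_ofEdges_eq (hc : IsRose c) {x y : Σ _ : FreeGroup ι × ι, I}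
    (h : ofEdges x = ofEdges y) : c (x.1.2, x.2) = c (y.1.2, y.2) := by
  have key : ∀ {x y : Σ _ : FreeGroup ι × ι, I}, ofEdges x = ofEdges y →
      x = y ∨ (x.2 = 0 ∨ x.2 = 1) := by
    rintro ⟨⟨g, e⟩, t⟩ ⟨⟨g', e'⟩, t'⟩ h
    by_contra! hxy
    obtain ⟨hxy, h₀, h₁⟩ := hxy
    obtain ⟨rfl, rfl, ht⟩ := edgePoint_injective (unitInterval.pos_iff_ne_zero.2 h₀)
      (unitInterval.lt_one_iff_ne_one.2 h₁) (congrArg Subtype.val h)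
    exact hxy (congrArg (Sigma.mk (g, e)) (Subtype.ext ht))
  rw [hc.apply_eq_iff]
  obtain rfl | hx := key h
  · exact Or.inl rfl
  · obtain rfl | hy := key h.symm
    · exact Or.inl rfl
    · exact Or.inr ⟨hx, hy⟩

/-- The projection of the tree to a wedge of circles, which maps the edges from `g` to `g * e` to
the circle with index `e`. -/
def proj (hc : IsRose c) : C(CayleyTree ι, X) :=
  IsQuotientMap.lift (f := ⟨ofEdges, continuous_ofEdges⟩) isQuotientMap_ofEdges
    ⟨fun x => c (x.1.2, x.2), continuous_sigma fun x =>
      c.continuous.comp (continuous_const.prodMk continuous_id : Continuous fun t : I => (x.2, t))⟩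
    fun _ _ h => apply_eq_of_ofEdges_eq hc h

theorem proj_ofEdges (hc : IsRose c) (g : FreeGroup ι) (e : ι) (t : I) :
    proj hc (ofEdges ⟨(g, e), t⟩) = c (e, t) :=
  congrArg (fun f : C(Σ _ : FreeGroup ι × ι, I, X) => f ⟨(g, e), t⟩)
    (IsQuotientMap.lift_comp (f := ⟨ofEdges, continuous_ofEdges⟩) isQuotientMap_ofEdges
    ⟨fun x => c (x.1.2, x.2), continuous_sigma fun x =>
      c.continuous.comp (continuous_const.prodMk continuous_id : Continuous fun t : I => (x.2, t))⟩
    fun _ _ h => apply_eq_of_ofEdges_eq hc h)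

/-- The Cayley tree is a covering of the wedge of circles, with the free group as group of deck
transformations. -/
theorem isQuotientCoveringMap_proj [DiscreteTopology ι] (hc : IsRose c) :
    IsQuotientCoveringMap (proj hc) (FreeGroup ι) where
  toIsQuotientMap := by
    -- the composite of the inclusion of the edges that start at `1` with `proj hc` is `c`
    refine IsQuotientMap.of_comp (f := fun x : ι × I => ofEdges ⟨(1, x.1), x.2⟩) ?_
      (proj hc).continuous ?_
    · refine continuous_ofEdges.comp ?_
      rw [continuous_prod_of_discrete_left]
      exact fun e => (continuous_sigmaMk : Continuous
        (Sigma.mk (β := fun _ : FreeGroup ι × ι => I) (1, e)))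
    · convert hc.isQuotientMap using 1
      exact funext fun x => proj_ofEdges hc 1 x.1 x.2
  continuous_const_smul := continuous_const_smul
  apply_eq_iff_mem_orbit := by
    intro x y
    obtain ⟨⟨⟨g, e⟩, t⟩, rfl⟩ := ofEdges_surjective x
    obtain ⟨⟨⟨h, e'⟩, t'⟩, rfl⟩ := ofEdges_surjective y
    have hv : ∀ (g : FreeGroup ι) (e a : ι) (t : I), (t = 0 ∨ t = 1) →
        ∃ v, ofEdges ⟨(g, e), t⟩ = ofEdges ⟨(v, a), 0⟩ := by
      rintro g e a t (rfl | rfl)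
      · exact ⟨_, ofEdges_zero _ _ _⟩
      · exact ⟨_, ofEdges_one _ _ _⟩
    constructor
    · rw [proj_ofEdges, proj_ofEdges, hc.apply_eq_iff]
      rintro (he | ⟨h₁, h₂⟩)
      · obtain ⟨rfl, rfl⟩ := Prod.ext_iff.1 he
        exact ⟨g * h⁻¹, by simp only [smul_ofEdges, inv_mul_cancel_right]⟩
      · obtain ⟨v, hv₁⟩ := hv g e e t h₁
        obtain ⟨w, hw⟩ := hv h e' e t' h₂
        exact ⟨v * w⁻¹, by simp only [hv₁, hw, smul_ofEdges, inv_mul_cancel_right]⟩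
    · rintro ⟨k, hk⟩
      simp only [smul_ofEdges] at hk
      rw [← hk, proj_ofEdges, proj_ofEdges]
  disjoint := exists_nhds_disjoint

theorem proj_root [Nonempty ι] (hc : IsRose c) (e : ι) : proj hc root = c (e, 0) := by
  rw [root_eq e, proj_ofEdges]

end CayleyTree

/-! ### Points of the `α`-cover -/

namespace AlphaCover

variable {X A : Type} [TopologicalSpace X] [CommGroup A] {x₀ : X} (α : FundamentalGroup X x₀ →* A)

/-- The value of `α` on the class of a loop. -/
def loopValue (l : Path x₀ x₀) : A :=
  α (FundamentalGroup.fromPath (Path.Homotopic.Quotient.mk l))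

/-- The point `[P, a]` of the `α`-cover. -/
def ofPath {y : X} (P : Path x₀ y) (a : A) : AlphaCover α :=
  Quotient.mk (AlphaCover.setoid α) (⟨P.toContinuousMap, P.source⟩, a)

theorem smul_ofPath {y : X} (P : Path x₀ y) (a b : A) :
    b • ofPath α P a = ofPath α P (b * a) := rfl

theorem proj_ofPath {y : X} (P : Path x₀ y) (a : A) : proj α (ofPath α P a) = y := P.target

theorem proj_smul (b : A) (e : AlphaCover α) : proj α (b • e) = proj α e := by
  obtain ⟨γ, a⟩ := e
  rfl

theorem ofPath_congr {y z : X} {P : Path x₀ y} {Q : Path x₀ z} (h : ∀ t, P t = Q t) (a : A) :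
    ofPath α P a = ofPath α Q a :=
  congrArg (fun γ : BasedPath X x₀ => Quotient.mk (AlphaCover.setoid α) (γ, a))
    (Subtype.ext (ContinuousMap.ext h))

theorem ofPath_eq {y : X} (P Q : Path x₀ y) (a : A) :
    ofPath α P a = ofPath α Q (loopValue α (P.trans Q.symm) * a) :=
  Quotient.sound ⟨y, P, Q, rfl, rfl, rfl⟩

theorem loopValue_eq_of_mk_eq {l l' : Path x₀ x₀}
    (h : Path.Homotopic.Quotient.mk l = Path.Homotopic.Quotient.mk l') :
    loopValue α l = loopValue α l' := by rw [loopValue, h, loopValue]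

theorem loopValue_refl : loopValue α (Path.refl x₀) = 1 := map_one α

theorem ofPath_eq_of_homotopic {y : X} {P Q : Path x₀ y} (h : P.Homotopic Q) (a : A) :
    ofPath α P a = ofPath α Q a := by
  rw [ofPath_eq α P Q, loopValue_eq_of_mk_eq α (l' := Path.refl x₀), loopValue_refl, one_mul]
  rw [Path.Homotopic.Quotient.mk_trans, Path.Homotopic.Quotient.mk_symm,
    Path.Homotopic.Quotient.eq.2 h, Path.Homotopic.Quotient.trans_symm]
  rfl

theorem ofPath_trans {y : X} (l : Path x₀ x₀) (P : Path x₀ y) (a : A) :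
    ofPath α (l.trans P) a = ofPath α P (loopValue α l * a) := by
  rw [ofPath_eq α _ P, loopValue_eq_of_mk_eq α (l' := l)]
  simp only [Path.Homotopic.Quotient.mk_trans, Path.Homotopic.Quotient.mk_symm]
  rw [Path.Homotopic.Quotient.trans_assoc, Path.Homotopic.Quotient.trans_symm,
    Path.Homotopic.Quotient.trans_refl]

theorem ofPath_injective {y : X} (P : Path x₀ y) : Function.Injective (ofPath α P) := by
  intro a b h
  obtain ⟨z, Q, R, hQ, hR, h⟩ := Quotient.exact h
  have hyz : z = y := Q.target.symm.trans ((congrArg (fun f => f 1) hQ).trans P.target)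
  subst hyz
  have e : Q = R := by
    ext t
    exact (congrArg (fun f => f t) hQ).trans (congrArg (fun f => f t) hR).symm
  subst e
  change b = loopValue α (Q.trans Q.symm) * a at h
  rw [loopValue_eq_of_mk_eq α (l' := Path.refl x₀), loopValue_refl, one_mul] at h
  · exact h.symm
  · rw [Path.Homotopic.Quotient.mk_trans, Path.Homotopic.Quotient.mk_symm,
      Path.Homotopic.Quotient.trans_symm]
    rfl

theorem smul_left_injective (e : AlphaCover α) : Function.Injective fun a : A => a • e := by
  obtain ⟨⟨γ, hγ⟩, a⟩ := e
  intro b c h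
  have := ofPath_injective α (y := γ 1) ⟨γ, hγ, rfl⟩ (a₁ := b * a) (a₂ := c * a) h
  exact mul_right_cancel this

end AlphaCover

/-! ### Comparison with a contractible covering -/

/-- A covering of `X` by a space `T`, with group `G` of deck transformations, and a contraction of
`T` to a base point. -/
structure ContractibleCovering (G T X : Type) [Group G] [TopologicalSpace T] [MulAction G T]
    [TopologicalSpace X] where
  /-- The covering projection. -/
  p : C(T, X)
  isQuotientCoveringMap : IsQuotientCoveringMap p G
  /-- The point to which `T` contracts. -/
  base : T
  /-- The contraction; it starts with the constant map. -/
  contraction : C(I × T, T)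
  contraction_zero (x : T) : contraction (0, x) = base
  contraction_one (x : T) : contraction (1, x) = x

namespace ContractibleCovering

variable {G T X A : Type} [Group G] [TopologicalSpace T] [MulAction G T] [TopologicalSpace X]
  [CommGroup A] (C : ContractibleCovering G T X)

include C in
theorem contractibleSpace : ContractibleSpace T := by
  rw [contractible_iff_id_nullhomotopic]
  refine ⟨C.base, ⟨ContinuousMap.Homotopy.symm ⟨C.contraction, ?_, ?_⟩⟩⟩
  · exact C.contraction_zero
  · exact C.contraction_one

include C in
theorem simplyConnectedSpace : SimplyConnectedSpace T :=
  have := C.contractibleSpace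
  inferInstance

theorem isCoveringMap : IsCoveringMap C.p := C.isQuotientCoveringMap.isCoveringMap

/-- The track of a point under the contraction. -/
def track (x : T) : Path C.base x where
  toFun t := C.contraction (t, x)
  source' := C.contraction_zero x
  target' := C.contraction_one x

variable (α : FundamentalGroup X (C.p C.base) →* A)

/-- The lift `T → X̃` of the covering projection. -/
def toAlphaCover : C(T, AlphaCover α) where
  toFun x := AlphaCover.ofPath α ((C.track x).map C.p.continuous) 1
  continuous_toFun := by
    let _ : TopologicalSpace A := ⊥
    have h : Continuous fun x : T => (⟨((C.track x).map C.p.continuous).toContinuousMap,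
        ((C.track x).map C.p.continuous).source⟩ : BasedPath X (C.p C.base)) := by
      refine Continuous.subtype_mk ?_ _
      exact ((C.p.comp C.contraction).comp ContinuousMap.prodSwap).curry.continuous
    exact (continuous_quotient_mk' (s := AlphaCover.setoid α)).comp
      (h.prodMk (continuous_const (y := (1 : A))))

theorem proj_toAlphaCover (x : T) : AlphaCover.proj α (C.toAlphaCover α x) = C.p x :=
  AlphaCover.proj_ofPath α _ _

/-- The lift of a point can be computed from any path. -/
theorem toAlphaCover_eq {x : T} (P : Path C.base x) :
    C.toAlphaCover α x = AlphaCover.ofPath α (P.map C.p.continuous) 1 := by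
  have := C.simplyConnectedSpace
  exact AlphaCover.ofPath_eq_of_homotopic α
    ((SimplyConnectedSpace.paths_homotopic _ _).map C.p) 1

/-- The loop in `X` which lifts to a path from the base point to its translate by `g`. -/
def loop (g : G) : Path (C.p C.base) (C.p C.base) :=
  ((C.track (g • C.base)).map C.p.continuous).cast rfl (C.isQuotientCoveringMap.map_smul g).symm

theorem toAlphaCover_smul' (g : G) (x : T) :
    C.toAlphaCover α (g • x) = AlphaCover.loopValue α (C.loop g) • C.toAlphaCover α x := by
  have := C.isQuotientCoveringMap.toContinuousConstSMul
  have hg : Continuous fun y : T => g • y := continuous_const_smul g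
  rw [C.toAlphaCover_eq α ((C.track (g • C.base)).trans ((C.track x).map hg))]
  change _ = _ • AlphaCover.ofPath α ((C.track x).map C.p.continuous) 1
  rw [AlphaCover.smul_ofPath, ← AlphaCover.ofPath_trans]
  refine AlphaCover.ofPath_congr α (fun t => ?_) 1
  simp only [Path.map_coe, Function.comp_apply, Path.trans_apply]
  split_ifs
  · rfl
  · exact C.isQuotientCoveringMap.map_smul g

/-- The homomorphism from the group of deck transformations to `A` that corresponds to `α`. -/
def deckHom : G →* A where
  toFun g := AlphaCover.loopValue α (C.loop g)
  map_one' := by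
    refine AlphaCover.smul_left_injective α (C.toAlphaCover α C.base) ?_
    change AlphaCover.loopValue α (C.loop 1) • _ = (1 : A) • _
    rw [← C.toAlphaCover_smul', one_smul, one_smul]
  map_mul' g h := by
    refine AlphaCover.smul_left_injective α (C.toAlphaCover α C.base) ?_
    change AlphaCover.loopValue α (C.loop (g * h)) • _ = (_ * _) • _
    rw [← C.toAlphaCover_smul', mul_smul, mul_smul, C.toAlphaCover_smul', C.toAlphaCover_smul']

theorem toAlphaCover_smul (g : G) (x : T) :
    C.toAlphaCover α (g • x) = C.deckHom α g • C.toAlphaCover α x :=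
  C.toAlphaCover_smul' α g x

/-- The lift of a path that starts at the base point, as a continuous function of the path. -/
def liftPaths : C(I × BasedPath X (C.p C.base), T) :=
  C.isCoveringMap.liftHomotopy ⟨fun s => s.2.1 s.1, by fun_prop⟩
    (ContinuousMap.const _ C.base) fun γ => γ.2

theorem liftPaths_zero (γ : BasedPath X (C.p C.base)) : C.liftPaths (0, γ) = C.base :=
  C.isCoveringMap.liftHomotopy_zero _ _ _ _

theorem p_liftPaths (t : I) (γ : BasedPath X (C.p C.base)) : C.p (C.liftPaths (t, γ)) = γ.1 t :=
  congrFun (C.isCoveringMap.liftHomotopy_lifts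
    (⟨fun s => s.2.1 s.1, by fun_prop⟩ : C(I × BasedPath X (C.p C.base), X))
    (ContinuousMap.const _ C.base) fun γ => γ.2) (t, γ)

/-- The end point of the lift of a path, as a continuous function of the path. -/
def endpoint : C(BasedPath X (C.p C.base), T) := C.liftPaths.comp ⟨fun γ => (1, γ), by fun_prop⟩

theorem exists_path_endpoint (γ : BasedPath X (C.p C.base)) :
    ∃ P : Path C.base (C.endpoint γ), ∀ t, C.p (P t) = γ.1 t :=
  ⟨⟨C.liftPaths.comp ⟨fun t => (t, γ), by fun_prop⟩, C.liftPaths_zero γ, rfl⟩,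
    fun t => C.p_liftPaths t γ⟩

theorem smul_toAlphaCover_endpoint (γ : BasedPath X (C.p C.base)) (a : A) :
    a • C.toAlphaCover α (C.endpoint γ) = Quotient.mk (AlphaCover.setoid α) (γ, a) := by
  obtain ⟨P, hP⟩ := C.exists_path_endpoint γ
  rw [C.toAlphaCover_eq α P, AlphaCover.smul_ofPath, mul_one]
  exact AlphaCover.ofPath_congr α (Q := ⟨γ.1, γ.2, rfl⟩) hP a

theorem deckHom_ne_one (hα : α ≠ 1) : C.deckHom α ≠ 1 := by
  contrapose! hα
  ext l
  obtain ⟨l, rfl⟩ := Path.Homotopic.Quotient.mk_surjective l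
  change AlphaCover.loopValue α l = 1
  -- the end point of the lift of `l` is a translate of the base point
  set γ : BasedPath X (C.p C.base) := ⟨l.toContinuousMap, l.source⟩ with hγ
  obtain ⟨P, hP⟩ := C.exists_path_endpoint γ
  have hend : C.p (C.endpoint γ) = C.p C.base := by
    rw [← P.target, hP]
    exact l.target
  obtain ⟨g, hg⟩ := C.isQuotientCoveringMap.apply_eq_iff_mem_orbit.1 hend
  have h₁ := C.smul_toAlphaCover_endpoint α γ 1
  simp only at hg
  rw [← hg, C.toAlphaCover_smul, hα, MonoidHom.one_apply, one_smul, one_smul,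
    C.toAlphaCover_eq α (Path.refl _)] at h₁
  have h₂ := AlphaCover.ofPath_trans α l (Path.refl _) 1
  rw [mul_one, AlphaCover.ofPath_eq_of_homotopic α (Q := l) ⟨Path.Homotopy.transRefl l⟩] at h₂
  exact (AlphaCover.ofPath_injective α _ ((h₁.trans h₂).trans
    (AlphaCover.ofPath_congr α (fun t => rfl) _))).symm

/-- The product `A × T`, where `A` is discrete and `g` acts by
`(a, x) ↦ (a * (deckHom g)⁻¹, g • x)`. Its quotient is the `α`-cover. -/
def TwistedProduct (_α : FundamentalGroup X (C.p C.base) →* A) : Type := A × T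

instance : TopologicalSpace (C.TwistedProduct α) :=
  letI : TopologicalSpace A := ⊥
  inferInstanceAs (TopologicalSpace (A × T))

instance : MulAction G (C.TwistedProduct α) where
  smul g x := (x.1 * (C.deckHom α g)⁻¹, g • x.2)
  one_smul x := by
    refine Prod.ext ?_ (one_smul G x.2)
    change x.1 * (C.deckHom α 1)⁻¹ = x.1
    rw [map_one, inv_one, mul_one]
  mul_smul g h x := by
    refine Prod.ext ?_ (mul_smul g h x.2)
    change x.1 * (C.deckHom α (g * h))⁻¹ = x.1 * (C.deckHom α h)⁻¹ * (C.deckHom α g)⁻¹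
    rw [map_mul, mul_inv_rev, mul_assoc]

/-- The projection from `A × T` to the `α`-cover. -/
def ofTwistedProduct (x : C.TwistedProduct α) : AlphaCover α := x.1 • C.toAlphaCover α x.2

theorem isQuotientCoveringMap_ofTwistedProduct :
    IsQuotientCoveringMap (C.ofTwistedProduct α) G where
  toIsQuotientMap := by
    let _ : TopologicalSpace A := ⊥
    have : DiscreteTopology A := ⟨rfl⟩
    have hcont : Continuous fun x : A × T => x.1 • C.toAlphaCover α x.2 := by
      rw [continuous_prod_of_discrete_left]
      intro a
      exact (C.toAlphaCover α).continuous.const_smul a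
    -- the quotient map which defines the `α`-cover factors through `ofTwistedProduct`
    have hlift : Continuous fun s : BasedPath X (C.p C.base) × A => (s.2, C.endpoint s.1) := by
      fun_prop
    have hquot : IsQuotientMap fun s : BasedPath X (C.p C.base) × A =>
        s.2 • C.toAlphaCover α (C.endpoint s.1) := by
      have e := funext fun s : BasedPath X (C.p C.base) × A =>
        C.smul_toAlphaCover_endpoint α s.1 s.2
      rw [e]
      exact isQuotientMap_quotient_mk' (s := AlphaCover.setoid α)
    exact IsQuotientMap.of_comp hlift hcont hquot
  continuous_const_smul g := by
    let _ : TopologicalSpace A := ⊥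
    have : DiscreteTopology A := ⟨rfl⟩
    have := C.isQuotientCoveringMap.toContinuousConstSMul
    change Continuous fun x : A × T => (x.1 * (C.deckHom α g)⁻¹, g • x.2)
    fun_prop
  apply_eq_iff_mem_orbit := by
    rintro ⟨a, x⟩ ⟨b, y⟩
    change a • C.toAlphaCover α x = b • C.toAlphaCover α y ↔ _
    constructor
    · intro h
      have hp := congrArg (AlphaCover.proj α) h
      rw [AlphaCover.proj_smul, AlphaCover.proj_smul, proj_toAlphaCover, proj_toAlphaCover] at hp
      obtain ⟨g, rfl⟩ := C.isQuotientCoveringMap.apply_eq_iff_mem_orbit.1 hp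
      simp only at h
      rw [C.toAlphaCover_smul, ← mul_smul] at h
      refine ⟨g, Prod.ext ?_ rfl⟩
      change b * (C.deckHom α g)⁻¹ = a
      rw [← AlphaCover.smul_left_injective α _ h, mul_inv_cancel_right]
    · rintro ⟨g, h⟩
      obtain ⟨rfl, rfl⟩ := Prod.ext_iff.1 h
      change (b * (C.deckHom α g)⁻¹) • C.toAlphaCover α (g • y) = _
      rw [C.toAlphaCover_smul, ← mul_smul, inv_mul_cancel_right]
  disjoint := by
    rintro ⟨a, x⟩
    let _ : TopologicalSpace A := ⊥
    have : DiscreteTopology A := ⟨rfl⟩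
    obtain ⟨U, hU, h⟩ := C.isQuotientCoveringMap.disjoint x
    refine ⟨Prod.snd ⁻¹' U, (continuous_snd (X := A) (Y := T)).continuousAt.preimage_mem_nhds hU, ?_⟩
    rintro g ⟨_, ⟨y, hy, rfl⟩, hgy⟩
    exact h g ⟨_, ⟨y.2, hy, rfl⟩, hgy⟩

/-- Maps from a simply connected space to the `α`-cover lift to `T`, up to a translation. -/
theorem exists_lift {Z : Type} [TopologicalSpace Z] [SimplyConnectedSpace Z]
    [LocallyPathConnectedSpace Z] (τ : C(Z, AlphaCover α)) :
    ∃ (a : A) (f : C(Z, T)), τ = a • (C.toAlphaCover α).comp f := by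
  have hQ := C.isQuotientCoveringMap_ofTwistedProduct α
  obtain ⟨z⟩ : Nonempty Z := inferInstance
  obtain ⟨e, he⟩ := hQ.surjective (τ z)
  obtain ⟨F, ⟨-, hF⟩, -⟩ := hQ.isCoveringMap.existsUnique_continuousMap_lifts τ z e he
  let _ : TopologicalSpace A := ⊥
  have : DiscreteTopology A := ⟨rfl⟩
  have h₁ : Continuous fun y => (F y).1 := (continuous_fst (X := A) (Y := T)).comp F.continuous
  have h₂ : Continuous fun y => (F y).2 := (continuous_snd (X := A) (Y := T)).comp F.continuous
  refine ⟨(F z).1, ⟨_, h₂⟩, ContinuousMap.ext fun y => ?_⟩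
  rw [← congrFun hF y]
  change (F y).1 • C.toAlphaCover α (F y).2 = (F z).1 • C.toAlphaCover α (F y).2
  rw [PreconnectedSpace.constant inferInstance h₁ (x := y) (y := z)]

/-- Lifts to `T` of a map to the `α`-cover are unique up to deck transformations. -/
theorem lift_unique {Z : Type} [TopologicalSpace Z] [ConnectedSpace Z] {a b : A} {f f' : C(Z, T)}
    (h : a • (C.toAlphaCover α).comp f = b • (C.toAlphaCover α).comp f') :
    ∃ g : G, (∀ z, f z = g • f' z) ∧ b = a * C.deckHom α g := by
  have h' : ∀ z, a • C.toAlphaCover α (f z) = b • C.toAlphaCover α (f' z) := fun z =>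
    congrArg (fun k : C(Z, AlphaCover α) => k z) h
  have hp : ∀ z, C.p (f z) = C.p (f' z) := by
    intro z
    have := congrArg (AlphaCover.proj α) (h' z)
    rwa [AlphaCover.proj_smul, AlphaCover.proj_smul, proj_toAlphaCover, proj_toAlphaCover] at this
  obtain ⟨z⟩ : Nonempty Z := inferInstance
  obtain ⟨g, hg⟩ := C.isQuotientCoveringMap.apply_eq_iff_mem_orbit.1 (hp z)
  have := C.isQuotientCoveringMap.toContinuousConstSMul
  have heq : (f : Z → T) = fun y => g • f' y :=
    C.isCoveringMap.eq_of_comp_eq f.continuous (f'.continuous.const_smul g)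
      (funext fun y => (hp y).trans (C.isQuotientCoveringMap.map_smul g).symm) z hg.symm
  refine ⟨g, congrFun heq, ?_⟩
  have := h' z
  rw [congrFun heq z, C.toAlphaCover_smul, ← mul_smul] at this
  exact (AlphaCover.smul_left_injective α _ this).symm

end ContractibleCovering

/-! ### Cones over singular simplices -/

instance (n : ℕ) : LocallyPathConnectedSpace (stdSimplex ℝ (Fin (n + 1))) :=
  (convex_stdSimplex ℝ (Fin (n + 1))).locallyPathConnectedSpace

instance (n : ℕ) : ContractibleSpace (stdSimplex ℝ (Fin (n + 1))) :=
  (convex_stdSimplex ℝ (Fin (n + 1))).contractibleSpace ⟨_, single_mem_stdSimplex ℝ 0⟩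

namespace SingularCone

/-- The point of the simplex `Δⁿ⁺¹` which divides the segment from the vertex `0` to the point `u`
of the opposite face in the ratio `s : 1 - s`. -/
def join {n : ℕ} (x : I × stdSimplex ℝ (Fin (n + 1))) : stdSimplex ℝ (Fin (n + 1 + 1)) :=
  ⟨Fin.cons (1 - x.1.1) fun i => x.1.1 * x.2 i, by
    refine ⟨fun i => ?_, ?_⟩
    · refine Fin.cases ?_ (fun j => ?_) i
      · rw [Fin.cons_zero]; linarith [x.1.2.2]
      · rw [Fin.cons_succ]; exact mul_nonneg x.1.2.1 (x.2.2.1 j)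
    · rw [Fin.sum_univ_succ, Fin.cons_zero]
      simp only [Fin.cons_succ, ← Finset.mul_sum]
      rw [stdSimplex.sum_eq_one, mul_one, sub_add_cancel]⟩

theorem join_apply_zero {n : ℕ} (s : I) (u : stdSimplex ℝ (Fin (n + 1))) :
    join (s, u) 0 = 1 - s.1 := rfl

theorem join_apply_succ {n : ℕ} (s : I) (u : stdSimplex ℝ (Fin (n + 1))) (i : Fin (n + 1)) :
    join (s, u) i.succ = s.1 * u i := rfl

theorem continuous_join {n : ℕ} : Continuous (join (n := n)) := by
  refine Continuous.subtype_mk (continuous_pi fun i => ?_) _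
  refine Fin.cases ?_ (fun j => ?_) i
  · simp only [Fin.cons_zero]; fun_prop
  · simp only [Fin.cons_succ]
    exact (continuous_subtype_val.comp continuous_fst).mul
      ((continuous_apply j).comp (continuous_subtype_val.comp continuous_snd))

theorem join_surjective {n : ℕ} : Function.Surjective (join (n := n)) := by
  intro v
  have hsum : v 0 + ∑ i : Fin (n + 1), v i.succ = 1 := by
    rw [← Fin.sum_univ_succ, stdSimplex.sum_eq_one]
  by_cases h : v 0 = 1
  · refine ⟨(0, Classical.arbitrary _), ?_⟩
    have hz : ∀ i : Fin (n + 1), v i.succ = 0 := by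
      rw [h, add_eq_left, Finset.sum_eq_zero_iff_of_nonneg fun i _ => stdSimplex.zero_le v _] at hsum
      exact fun i => hsum i (Finset.mem_univ i)
    ext i
    refine Fin.cases ?_ (fun j => ?_) i
    · rw [join_apply_zero, h]; simp
    · rw [join_apply_succ, hz]; simp
  · have hlt : v 0 < 1 := lt_of_le_of_ne (stdSimplex.le_one v 0) h
    have hne : 1 - v 0 ≠ 0 := by linarith
    refine ⟨(⟨1 - v 0, by linarith, by linarith [stdSimplex.zero_le v 0]⟩,
      ⟨fun i => v i.succ / (1 - v 0), fun i => div_nonneg (stdSimplex.zero_le v _) (by linarith),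
        ?_⟩), ?_⟩
    · rw [← Finset.sum_div, div_eq_one_iff_eq hne]; linarith
    · ext i
      refine Fin.cases ?_ (fun j => ?_) i
      · rw [join_apply_zero]; simp
      · rw [join_apply_succ]; exact mul_div_cancel₀ _ hne

theorem isQuotientMap_join {n : ℕ} : IsQuotientMap (join (n := n)) :=
  continuous_join.isClosedMap.isQuotientMap continuous_join join_surjective

theorem eq_of_join_eq {n : ℕ} {x y : I × stdSimplex ℝ (Fin (n + 1))} (h : join x = join y) :
    x.1 = y.1 ∧ (x.1 = 0 ∨ x.2 = y.2) := by
  obtain ⟨s, u⟩ := x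
  obtain ⟨t, v⟩ := y
  have h₀ := congrArg (fun w => w 0) h
  simp only [join_apply_zero, sub_right_inj] at h₀
  obtain rfl : s = t := Subtype.ext h₀
  refine ⟨rfl, or_iff_not_imp_left.2 fun hs => ?_⟩
  ext i
  have h₁ := congrArg (fun w => w i.succ) h
  simp only [join_apply_succ] at h₁
  exact mul_left_cancel₀ (fun h => hs (Subtype.ext h)) h₁

theorem map_join {m n : ℕ} (θ : Fin (m + 1) → Fin (n + 1)) (θ' : Fin (m + 2) → Fin (n + 2))
    (h₀ : θ' 0 = 0) (h : ∀ i, θ' (Fin.succ i) = (θ i).succ) (s : I)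
    (u : stdSimplex ℝ (Fin (m + 1))) :
    stdSimplex.map θ' (join (s, u)) = join (s, stdSimplex.map θ u) := by
  ext j
  rw [stdSimplex.map_coe, FunOnFinite.linearMap_apply_apply, Finset.sum_filter, Fin.sum_univ_succ]
  simp only [h₀, h, join_apply_zero, join_apply_succ]
  refine Fin.cases ?_ (fun k => ?_) j
  · simp [join_apply_zero, Fin.succ_ne_zero]
  · rw [join_apply_succ, stdSimplex.map_coe, FunOnFinite.linearMap_apply_apply, Finset.sum_filter,
      Finset.mul_sum, if_neg (Fin.succ_ne_zero k).symm, zero_add]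
    simp [Fin.succ_inj, mul_ite]

theorem map_succ {n : ℕ} (u : stdSimplex ℝ (Fin (n + 1))) :
    stdSimplex.map Fin.succ u = join (1, u) := by
  ext j
  rw [stdSimplex.map_coe, FunOnFinite.linearMap_apply_apply, Finset.sum_filter]
  refine Fin.cases ?_ (fun k => ?_) j
  · simp [join_apply_zero, Fin.succ_ne_zero]
  · simp [join_apply_succ, Fin.succ_inj]

variable {G T X : Type} [Group G] [TopologicalSpace T] [MulAction G T] [TopologicalSpace X]
  (C : ContractibleCovering G T X)

theorem contraction_eq_of_join_eq {n : ℕ} (τ : C(stdSimplex ℝ (Fin (n + 1)), T))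
    {x y : I × stdSimplex ℝ (Fin (n + 1))} (h : join x = join y) :
    C.contraction (x.1, τ x.2) = C.contraction (y.1, τ y.2) := by
  obtain ⟨h₁, h₂ | h₂⟩ := eq_of_join_eq h
  · rw [← h₁, h₂, C.contraction_zero, C.contraction_zero]
  · rw [h₁, h₂]

/-- The cone over a singular simplex, whose vertex is the point to which the space contracts. -/
def cone {n : ℕ} (τ : C(stdSimplex ℝ (Fin (n + 1)), T)) : C(stdSimplex ℝ (Fin (n + 1 + 1)), T) :=
  IsQuotientMap.lift (f := ⟨join, continuous_join⟩) isQuotientMap_join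
    ⟨fun x => C.contraction (x.1, τ x.2), by fun_prop⟩
    fun _ _ h => contraction_eq_of_join_eq C τ h

theorem cone_join {n : ℕ} (τ : C(stdSimplex ℝ (Fin (n + 1)), T)) (s : I)
    (u : stdSimplex ℝ (Fin (n + 1))) : cone C τ (join (s, u)) = C.contraction (s, τ u) :=
  congrArg (fun f : C(I × stdSimplex ℝ (Fin (n + 1)), T) => f (s, u))
    (IsQuotientMap.lift_comp (f := ⟨join, continuous_join⟩) isQuotientMap_join
      ⟨fun x => C.contraction (x.1, τ x.2), by fun_prop⟩
      fun _ _ h => contraction_eq_of_join_eq C τ h)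

theorem cone_map {m n : ℕ} (θ : Fin (m + 1) → Fin (n + 1)) (θ' : Fin (m + 2) → Fin (n + 2))
    (h₀ : θ' 0 = 0) (h : ∀ i, θ' (Fin.succ i) = (θ i).succ)
    (τ : C(stdSimplex ℝ (Fin (n + 1)), T)) :
    (cone C τ).comp ⟨stdSimplex.map θ', stdSimplex.continuous_map θ'⟩ =
      cone C (τ.comp ⟨stdSimplex.map θ, stdSimplex.continuous_map θ⟩) := by
  ext v
  obtain ⟨⟨s, u⟩, rfl⟩ := join_surjective v
  simp only [ContinuousMap.comp_apply, ContinuousMap.coe_mk]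
  rw [map_join θ θ' h₀ h, cone_join, cone_join]
  rfl

/-- Copies, indexed by `J`, of the simplicial set of singular simplices of `T`, with the augmentation
to `J`. -/
def singularSet (J T : Type) [TopologicalSpace T] : SimplicialObject.Augmented Type where
  left :=
    { obj := fun n => J × C(stdSimplex ℝ (Fin (n.unop.len + 1)), T)
      map := fun g => ↾fun x =>
        (x.1, x.2.comp ⟨stdSimplex.map g.unop, stdSimplex.continuous_map g.unop⟩)
      map_id := fun n => by
        refine ConcreteCategory.hom_ext _ _ ?_
        rintro ⟨j, τ⟩
        have h : τ.comp ⟨stdSimplex.map (𝟙 n.unop : n.unop ⟶ n.unop),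
            stdSimplex.continuous_map _⟩ = τ :=
          ContinuousMap.ext fun t => congrArg τ (stdSimplex.map_id_apply t)
        exact congrArg (Prod.mk j) h
      map_comp := fun f g => by
        refine ConcreteCategory.hom_ext _ _ ?_
        rintro ⟨j, τ⟩
        have h : τ.comp ⟨stdSimplex.map (g.unop ≫ f.unop), stdSimplex.continuous_map _⟩ =
            (τ.comp ⟨stdSimplex.map f.unop, stdSimplex.continuous_map _⟩).comp
              ⟨stdSimplex.map g.unop, stdSimplex.continuous_map _⟩ :=
          ContinuousMap.ext fun t =>
            congrArg τ (stdSimplex.map_comp_apply g.unop f.unop t).symm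
        exact congrArg (Prod.mk j) h }
  right := J
  hom := { app := fun _ => ↾Prod.fst }

/-- Coning off is an extra degeneracy. -/
def extraDegeneracy (J : Type) : (singularSet J T).ExtraDegeneracy where
  s' := ↾fun j => (j, ContinuousMap.const _ C.base)
  s n := ↾fun x => (x.1, cone C x.2)
  s'_comp_ε := rfl
  s₀_comp_δ₁ := by
    ext x
    refine Prod.ext rfl (ContinuousMap.ext fun t => ?_)
    have h : stdSimplex.map (SimplexCategory.δ (1 : Fin 2)) t = join (0, t) := by
      have ht : t = stdSimplex.vertex 0 := Subsingleton.elim (α := stdSimplex ℝ (Fin 1)) _ _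
      rw [ht, stdSimplex.map_vertex]
      ext i
      refine Fin.cases ?_ (fun j => ?_) i
      · change (Pi.single (0 : Fin 2) (1 : ℝ) : Fin 2 → ℝ) 0 = 1 - 0
        simp
      · change (Pi.single (0 : Fin 2) (1 : ℝ) : Fin 2 → ℝ) j.succ = 0 * _
        simp [Fin.succ_ne_zero]
    change cone C x.2 (stdSimplex.map (SimplexCategory.δ (1 : Fin 2)) t) = C.base
    rw [h, cone_join, C.contraction_zero]
  s_comp_δ₀ n := by
    ext x
    refine Prod.ext rfl (ContinuousMap.ext fun t => ?_)
    change cone C x.2 (stdSimplex.map Fin.succ t) = x.2 t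
    rw [map_succ, cone_join, C.contraction_one]
  s_comp_δ n i := by
    ext x
    refine Prod.ext rfl ?_
    exact cone_map C (SimplexCategory.δ i) (SimplexCategory.δ i.succ) rfl
      (fun j => Fin.succ_succAbove_succ i j) x.2
  s_comp_σ n i := by
    ext x
    refine Prod.ext rfl ?_
    exact cone_map C (SimplexCategory.σ i) (SimplexCategory.σ i.succ) rfl
      (fun j => Fin.succ_predAbove_succ i j) x.2

end SingularCone

/-! ### The vector space generated by a set with an action -/

namespace TwistedFree

variable {A : Type} [CommGroup A]

/-- The elements of `A` as scalars in the fraction ring of `ℤ[A]`. -/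
def scalar (A : Type) [CommGroup A] : A →* QuotGroupRing A :=
  (algebraMap (MonoidAlgebra ℤ A) (QuotGroupRing A) : _ →* _).comp (MonoidAlgebra.of ℤ A)

theorem scalar_inv_mul (a : A) : scalar A a⁻¹ * scalar A a = 1 := by
  rw [← map_mul, inv_mul_cancel, map_one]

variable (A) in
/-- Extension of scalars from `ℤ[A]` to its fraction ring. -/
abbrev extend : ModuleCat.{0} (MonoidAlgebra ℤ A) ⥤ ModuleCat.{0} (QuotGroupRing A) :=
  ModuleCat.extendScalars (algebraMap (MonoidAlgebra ℤ A) (QuotGroupRing A))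

variable {S S' : Type} [MulAction A S] [MulAction A S']

/-- The multiples of the generators of `ℤ[S]`. -/
def freeGen (s : S) (m : ℤ) : freeModule A S := (Finsupp.single s m : S →₀ ℤ)

theorem single_smul_freeGen (a : A) (n m : ℤ) (s : S) :
    (MonoidAlgebra.single a n : MonoidAlgebra ℤ A) • (freeGen s m : freeModule A S) =
      freeGen (a • s) (n * m) := by
  refine (Representation.single_smul (freeRep A S) n a _).trans ?_
  change n • Finsupp.mapDomain (a • ·) (Finsupp.single s m) = Finsupp.single (a • s) (n * m)
  rw [Finsupp.mapDomain_single, Finsupp.smul_single, smul_eq_mul]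

theorem freeModule_induction {motive : freeModule A S → Prop} (v : freeModule A S)
    (zero : motive 0) (add : ∀ v w, motive v → motive w → motive (v + w))
    (single : ∀ s m, motive (freeGen s m)) : motive v :=
  Finsupp.induction_linear (motive := motive) v zero add single

theorem freeGen_eq_zsmul (s : S) (m : ℤ) : (freeGen s m : freeModule A S) = m • freeGen s 1 := by
  change Finsupp.single s m = m • Finsupp.single s (1 : ℤ)
  rw [Finsupp.smul_single, smul_eq_mul, mul_one]

/-- The generator `1 ⊗ s` of the module obtained from `ℤ[S]` by extension of scalars. -/
def gen (s : S) : (extend A).obj (freeModule A S) :=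
  ((ModuleCat.extendRestrictScalarsAdj (algebraMap (MonoidAlgebra ℤ A) (QuotGroupRing A))).unit.app
    (freeModule A S)).hom (freeGen s 1)

theorem gen_smul (a : A) (s : S) : (gen (a • s) : (extend A).obj (freeModule A S)) =
    scalar A a • gen s := by
  have h := single_smul_freeGen a 1 1 s
  rw [mul_one] at h
  rw [gen, ← h, map_smul]
  rfl

theorem map_gen (f : S →[A] S') (s : S) :
    ((extend A).map (freeModuleMap f)).hom (gen s) = gen (f s) := by
  have h := congrArg (fun k => k.hom (freeGen s 1))
    ((ModuleCat.extendRestrictScalarsAdj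
      (algebraMap (MonoidAlgebra ℤ A) (QuotGroupRing A))).unit.naturality (freeModuleMap f))
  have e : (freeModuleMap f).hom (freeGen s 1) = freeGen (f s) 1 :=
    (freeModuleMap_apply A f _).trans Finsupp.mapDomain_single
  exact h.symm.trans (congrArg ((ModuleCat.extendRestrictScalarsAdj
    (algebraMap (MonoidAlgebra ℤ A) (QuotGroupRing A))).unit.app (freeModule A S')).hom e)

/-- Linear maps on `K ⊗ ℤ[S]` agree if they agree on the elements `1 ⊗ s`. -/
theorem hom_ext {N : ModuleCat.{0} (QuotGroupRing A)}
    {f g : (extend A).obj (freeModule A S) ⟶ N} (h : ∀ s : S, f.hom (gen s) = g.hom (gen s)) :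
    f = g := by
  refine ((ModuleCat.extendRestrictScalarsAdj
    (algebraMap (MonoidAlgebra ℤ A) (QuotGroupRing A))).homEquiv _ _).injective ?_
  ext v
  induction v using freeModule_induction with
  | zero => rw [map_zero, map_zero]
  | add v w hv hw => rw [map_add, map_add, hv, hw]
  | single s m =>
    rw [freeGen_eq_zsmul, map_zsmul, map_zsmul]
    exact congrArg (m • ·) (h s)

/-- The universal property of `K ⊗ ℤ[S]`: an `A`-equivariant map from `S` to a vector space extends
to a linear map. -/
theorem exists_desc {N : ModuleCat.{0} (QuotGroupRing A)} (f : S → N)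
    (hf : ∀ (a : A) (s : S), f (a • s) = scalar A a • f s) :
    ∃ F : (extend A).obj (freeModule A S) ⟶ N, ∀ s, F.hom (gen s) = f s := by
  let adj := ModuleCat.extendRestrictScalarsAdj
    (algebraMap (MonoidAlgebra ℤ A) (QuotGroupRing A))
  let F₀ : freeModule A S →+ N := (Finsupp.liftAddHom fun s => zmultiplesHom N (f s) :
    (S →₀ ℤ) →+ N)
  have hF₀ : ∀ s m, F₀ (freeGen s m) = m • f s := fun s m =>
    Finsupp.liftAddHom_apply_single (fun s => zmultiplesHom N (f s)) s m
  have hsmul : ∀ (r : MonoidAlgebra ℤ A) (v : freeModule A S),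
      F₀ (r • v) = algebraMap (MonoidAlgebra ℤ A) (QuotGroupRing A) r • F₀ v := by
    intro r v
    induction r using MonoidAlgebra.induction_linear with
    | zero => rw [zero_smul, map_zero, map_zero, zero_smul]
    | add r r' h h' => rw [add_smul, map_add, map_add, add_smul, h, h']
    | single a n =>
      induction v using freeModule_induction with
      | zero => rw [smul_zero, map_zero, smul_zero]
      | add v w hv hw => rw [smul_add, map_add, map_add, smul_add, hv, hw]
      | single s m =>
        have e : (MonoidAlgebra.single a n : MonoidAlgebra ℤ A) = n • MonoidAlgebra.of ℤ A a := by
          simp [MonoidAlgebra.of_apply]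
        rw [single_smul_freeGen, hF₀, hF₀, hf, e, map_zsmul, smul_assoc, mul_smul]
        congr 1
        exact (smul_comm _ _ _)
  let F : freeModule A S ⟶ (ModuleCat.restrictScalars
      (algebraMap (MonoidAlgebra ℤ A) (QuotGroupRing A))).obj N :=
    ModuleCat.ofHom (Y := (ModuleCat.restrictScalars
      (algebraMap (MonoidAlgebra ℤ A) (QuotGroupRing A))).obj N)
      { toFun := F₀, map_add' := map_add F₀, map_smul' := hsmul }
  refine ⟨(adj.homEquiv _ _).symm F, fun s => ?_⟩
  have h := congrArg (fun k => k.hom (freeGen s 1)) ((adj.homEquiv _ _).apply_symm_apply F)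
  refine Eq.trans h ((hF₀ s 1).trans (one_smul _ _))

/-! ### A resolution of length one -/

/-- The elements `1 ⊗ s` generate `K ⊗ ℤ[S]`. -/
theorem eq_top_of_gen_mem {W : Submodule (QuotGroupRing A) ((extend A).obj (freeModule A S))}
    (h : ∀ s : S, gen s ∈ W) : W = ⊤ := by
  have e : ModuleCat.ofHom W.mkQ = (0 : (extend A).obj (freeModule A S) ⟶ ModuleCat.of _ (_ ⧸ W)) :=
    hom_ext fun s => (Submodule.Quotient.mk_eq_zero W).2 (h s)
  have := congrArg (fun k => LinearMap.ker k.hom) e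
  simpa using this

variable {ι P : Type} [MulAction (FreeGroup ι) P]

variable (ρ : FreeGroup ι →* A)

/-- The map `(e, s) ↦ e • s - ρ e * s` from the vector space generated by copies, indexed by `ι`, of a
set `P` with an action of the free group on `ι`, to the vector space generated by `P`. The latter is
written with the index set `Unit`, so that both are values of the same functor. -/
def relation : (ModuleCat.free (QuotGroupRing A)).obj (ι × P) ⟶
    (ModuleCat.free (QuotGroupRing A)).obj (Unit × P) :=
  ModuleCat.freeDesc (↾fun x => ModuleCat.freeMk ((), FreeGroup.of x.1 • x.2) -
    scalar A (ρ (FreeGroup.of x.1)) • ModuleCat.freeMk ((), x.2))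

theorem relation_freeMk (e : ι) (s : P) :
    relation ρ (ModuleCat.freeMk (e, s)) = ModuleCat.freeMk ((), FreeGroup.of e • s) -
      scalar A (ρ (FreeGroup.of e)) • ModuleCat.freeMk ((), s) :=
  ModuleCat.freeDesc_apply _ _

/-- The map `t ↦ 1 ⊗ q t`. -/
def toExtend (q : P → S) : (ModuleCat.free (QuotGroupRing A)).obj (Unit × P) ⟶
    (extend A).obj (freeModule A S) :=
  ModuleCat.freeDesc (↾fun x => gen (q x.2))

theorem toExtend_freeMk (q : P → S) (s : P) :
    toExtend q (ModuleCat.freeMk ((), s)) = (gen (q s) : (extend A).obj (freeModule A S)) :=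
  ModuleCat.freeDesc_apply _ _

theorem relation_comp_toExtend {q : P → S} (hq : ∀ g s, q (g • s) = ρ g • q s) :
    relation ρ ≫ toExtend q = 0 := by
  refine ModuleCat.free_hom_ext fun ⟨e, s⟩ => ?_
  rw [ModuleCat.comp_apply, relation_freeMk, map_sub, map_smul, toExtend_freeMk, toExtend_freeMk, hq,
    gen_smul, sub_self]
  rfl

theorem toExtend_surjective {q : P → S} (hsurj : ∀ t, ∃ (a : A) (s : P), t = a • q s) :
    Function.Surjective (toExtend q : _ ⟶ (extend A).obj (freeModule A S)).hom := by
  rw [← LinearMap.range_eq_top]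
  refine eq_top_of_gen_mem fun t => ?_
  obtain ⟨a, s, rfl⟩ := hsurj t
  rw [gen_smul]
  exact Submodule.smul_mem _ _ ⟨_, toExtend_freeMk q s⟩

/-- If the `a • q s` exhaust `S`, and coincide only where the translations by the free group make
them coincide, then the relations `e • s = ρ e * s` of the free generators present `K ⊗ ℤ[S]`. -/
theorem exact_relation_toExtend {q : P → S}
    (hsurj : ∀ t, ∃ (a : A) (s : P), t = a • q s)
    (hinj : ∀ (a b : A) (s s' : P), a • q s = b • q s' → ∃ g, s = g • s' ∧ b = a * ρ g)
    (x : (ModuleCat.free (QuotGroupRing A)).obj (Unit × P))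
    (hx : (toExtend q : _ ⟶ (extend A).obj (freeModule A S)) x = 0) :
    ∃ y, relation ρ y = x := by
  set W := LinearMap.range (relation (P := P) ρ).hom with hW
  have hgen : ∀ (g : FreeGroup ι) (s : P),
      W.mkQ (ModuleCat.freeMk ((), g • s)) = scalar A (ρ g) • W.mkQ (ModuleCat.freeMk ((), s)) := by
    intro g
    have hinv : ∀ g : FreeGroup ι, (∀ s : P, W.mkQ (ModuleCat.freeMk ((), g • s)) =
        scalar A (ρ g) • W.mkQ (ModuleCat.freeMk ((), s))) → ∀ s : P,
        W.mkQ (ModuleCat.freeMk ((), g⁻¹ • s)) =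
          scalar A (ρ g⁻¹) • W.mkQ (ModuleCat.freeMk ((), s)) := by
      intro g h s
      have := h (g⁻¹ • s)
      rw [smul_inv_smul] at this
      rw [this, ← mul_smul, map_inv, scalar_inv_mul, one_smul]
    have hof : ∀ (e : ι) (s : P), W.mkQ (ModuleCat.freeMk ((), FreeGroup.of e • s)) =
        scalar A (ρ (FreeGroup.of e)) • W.mkQ (ModuleCat.freeMk ((), s)) := by
      intro e s
      rw [← map_smul, ← sub_eq_zero, ← map_sub]
      exact (Submodule.Quotient.mk_eq_zero W).2 ⟨_, relation_freeMk ρ e s⟩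
    induction g using FreeGroup.induction_on with
    | C1 => intro s; rw [one_smul, map_one, map_one, one_smul]
    | of e => exact hof e
    | inv_of e h => exact hinv _ h
    | mul g h hg hh =>
      intro s
      rw [mul_smul, hg, hh, map_mul, map_mul, mul_smul]
  choose a s has using hsurj
  -- the inverse of the map from the cokernel of `relation`
  obtain ⟨F, hF⟩ := exists_desc (N := ModuleCat.of (QuotGroupRing A) (_ ⧸ W))
    (fun t => scalar A (a t) • W.mkQ (ModuleCat.freeMk ((), s t))) (by
      intro b t
      have h := (has (b • t)).symm.trans (congrArg (b • ·) (has t))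
      simp only [← mul_smul] at h
      obtain ⟨g, h₁, h₂⟩ := hinj _ _ _ _ h
      rw [h₁, hgen, ← mul_smul, ← mul_smul, ← map_mul, ← map_mul, h₂])
  have e : toExtend q ≫ F = ModuleCat.ofHom W.mkQ := by
    refine ModuleCat.free_hom_ext fun ⟨_, t⟩ => ?_
    rw [ModuleCat.comp_apply, toExtend_freeMk]
    refine (hF _).trans ?_
    obtain ⟨g, h₁, h₂⟩ := hinj 1 (a (q t)) t (s (q t)) ((one_smul _ _).trans (has (q t)))
    change _ = W.mkQ (ModuleCat.freeMk ((), t))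
    rw [h₂, one_mul, ← hgen, ← h₁]
  have h := congrArg (fun k => k.hom x) e
  have h₀ : W.mkQ x = 0 := by
    refine h.symm.trans ?_
    change F ((toExtend q) x) = 0
    rw [hx, map_zero]
  exact (Submodule.Quotient.mk_eq_zero W).1 h₀

/-- The permutation of `K[ι × P] × P` in terms of which the Fox derivatives, which split `relation`,
are defined. -/
def foxPerm (e : ι) : Equiv.Perm ((ι × P →₀ QuotGroupRing A) × P) where
  toFun x := (Finsupp.single (e, x.2) 1 + scalar A (ρ (FreeGroup.of e)) • x.1,
    FreeGroup.of e • x.2)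
  invFun x := (scalar A (ρ (FreeGroup.of e))⁻¹ •
    (x.1 - Finsupp.single (e, (FreeGroup.of e)⁻¹ • x.2) 1), (FreeGroup.of e)⁻¹ • x.2)
  left_inv x := by
    refine Prod.ext ?_ (inv_smul_smul _ _)
    simp only [inv_smul_smul, add_sub_cancel_left]
    rw [← mul_smul, scalar_inv_mul, one_smul]
  right_inv x := by
    refine Prod.ext ?_ (smul_inv_smul _ _)
    simp only
    rw [← mul_smul, mul_comm, scalar_inv_mul, one_smul, add_sub_cancel]

theorem lift_foxPerm_snd (g : FreeGroup ι) (x : (ι × P →₀ QuotGroupRing A) × P) :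
    (FreeGroup.lift (foxPerm ρ) g x).2 = g • x.2 := by
  induction g using FreeGroup.induction_on generalizing x with
  | C1 => simp
  | of e => rw [FreeGroup.lift_apply_of]; rfl
  | inv_of e h =>
    rw [eq_inv_smul_iff, ← h, map_inv]
    exact congrArg Prod.snd ((FreeGroup.lift (foxPerm ρ) (FreeGroup.of e)).apply_symm_apply x)
  | mul g h hg hh => rw [map_mul, Equiv.Perm.mul_apply, hg, hh, mul_smul]

/-- For a free action, `relation` has a left inverse, which maps the generator of the point
`γ • r` in the orbit of a representative `r` to the Fox derivatives of `γ`. -/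
theorem relation_injective (hfree : ∀ (g : FreeGroup ι) (s : P), g • s = s → g = 1) :
    Function.Injective (relation (P := P) ρ).hom := by
  -- choose a representative `r s` of the orbit of `s`, and `γ s` with `γ s • r s = s`
  have hr : ∀ s : P, ∃ g : FreeGroup ι,
      g • (Quotient.mk (MulAction.orbitRel (FreeGroup ι) P) s).out = s :=
    fun s => (MulAction.orbitRel (FreeGroup ι) P).symm (Quotient.mk_out s)
  choose γ hγ using hr
  have hquot : ∀ (g : FreeGroup ι) (s : P), Quotient.mk (MulAction.orbitRel (FreeGroup ι) P) (g • s) =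
      Quotient.mk (MulAction.orbitRel (FreeGroup ι) P) s := fun g s => Quotient.sound ⟨g, rfl⟩
  have hγmul : ∀ (g : FreeGroup ι) (s : P), γ (g • s) = g * γ s := by
    intro g s
    have h := hγ (g • s)
    rw [hquot] at h
    conv_rhs at h => rw [← hγ s]
    rw [← inv_mul_eq_one]
    refine hfree _ (Quotient.mk (MulAction.orbitRel (FreeGroup ι) P) s).out ?_
    rw [mul_smul, mul_smul, ← h, inv_smul_smul]
  let D : P → (ι × P →₀ QuotGroupRing A) := fun s =>
    (FreeGroup.lift (foxPerm ρ) (γ s) (0, (Quotient.mk (MulAction.orbitRel (FreeGroup ι) P) s).out)).1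
  have hD : ∀ (e : ι) (s : P), D (FreeGroup.of e • s) =
      Finsupp.single (e, s) 1 + scalar A (ρ (FreeGroup.of e)) • D s := by
    intro e s
    simp only [D]
    rw [hγmul, hquot, map_mul, Equiv.Perm.mul_apply, FreeGroup.lift_apply_of]
    change Finsupp.single (e, (FreeGroup.lift (foxPerm ρ) (γ s) _).2) 1 + _ = _
    rw [lift_foxPerm_snd, hγ]
  let L : (ModuleCat.free (QuotGroupRing A)).obj (Unit × P) ⟶
      (ModuleCat.free (QuotGroupRing A)).obj (ι × P) := ModuleCat.freeDesc (↾fun x => D x.2)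
  have hL : ∀ s : P, L (ModuleCat.freeMk ((), s)) = D s := fun s => ModuleCat.freeDesc_apply _ _
  have e : relation ρ ≫ L = 𝟙 _ := by
    refine ModuleCat.free_hom_ext fun ⟨e, s⟩ => ?_
    rw [ModuleCat.comp_apply, relation_freeMk, map_sub, map_smul, hL, hL, hD]
    exact add_sub_cancel_right (G := ι × P →₀ QuotGroupRing A) _ _
  exact Function.LeftInverse.injective (g := L.hom) fun x => congrArg (fun k => k.hom x) e

end TwistedFree

/-! ### The short exact sequence of chain complexes -/

namespace TwistedFree

open AlgebraicTopology SingularCone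

variable {A : Type} [CommGroup A] {ι : Type} (ρ : FreeGroup ι →* A)

variable (A) in
/-- The augmented simplicial vector space generated by copies of the singular set of `T`. -/
abbrev singularFree (J T : Type) [TopologicalSpace T] :
    SimplicialObject.Augmented (ModuleCat.{0} (QuotGroupRing A)) :=
  ((SimplicialObject.Augmented.whiskering _ _).obj (ModuleCat.free (QuotGroupRing A))).obj
    (singularSet J T)

variable (A) in
/-- The chain complex of `singularFree`. -/
abbrev freeChains (J T : Type) [TopologicalSpace T] :
    ChainComplex (ModuleCat.{0} (QuotGroupRing A)) ℕ :=
  (alternatingFaceMapComplex _).obj (singularFree A J T).left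

theorem singularFree_map_freeMk {J T : Type} [TopologicalSpace T] {m n : SimplexCategoryᵒᵖ}
    (θ : m ⟶ n) (j : J) (s : C(stdSimplex ℝ (Fin (m.unop.len + 1)), T)) :
    (singularFree A J T).left.map θ (ModuleCat.freeMk (j, s)) =
      ModuleCat.freeMk (j, s.comp ⟨stdSimplex.map θ.unop, stdSimplex.continuous_map θ.unop⟩) :=
  ModuleCat.free_map_apply _ _

theorem map_sub_smul {M N : ModuleCat.{0} (QuotGroupRing A)} (F : M ⟶ N) (x y : M)
    (k : QuotGroupRing A) : F (x - k • y) = F x - k • F y := by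
  rw [map_sub, map_smul]

instance : (ModuleCat.restrictScalars.{0}
    (algebraMap (MonoidAlgebra ℤ A) (QuotGroupRing A))).Additive where
  map_add := rfl

instance : (extend A).Additive :=
  (ModuleCat.extendRestrictScalarsAdj
    (algebraMap (MonoidAlgebra ℤ A) (QuotGroupRing A))).left_adjoint_additive

variable {T : Type} [TopologicalSpace T] [MulAction (FreeGroup ι) T]
  [ContinuousConstSMul (FreeGroup ι) T]

/-- The map that `relation` induces on the augmentations. -/
def augRelation : (ModuleCat.free (QuotGroupRing A)).obj ι ⟶
    (ModuleCat.free (QuotGroupRing A)).obj Unit :=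
  ModuleCat.freeDesc (↾fun e => (1 - scalar A (ρ (FreeGroup.of e))) • ModuleCat.freeMk ())

theorem augRelation_freeMk (e : ι) : augRelation ρ (ModuleCat.freeMk e) =
    (1 - scalar A (ρ (FreeGroup.of e))) • ModuleCat.freeMk () :=
  ModuleCat.freeDesc_apply _ _

variable (T) in
/-- `relation` as a map of augmented simplicial vector spaces. -/
def singularRelation : singularFree A ι T ⟶ singularFree A Unit T where
  left :=
    { app := fun n => relation ρ (P := C(stdSimplex ℝ (Fin (n.unop.len + 1)), T))
      naturality := fun m n θ => by
        refine ModuleCat.free_hom_ext fun ⟨e, s⟩ => ?_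
        refine (congrArg (relation ρ) (singularFree_map_freeMk θ e s)).trans ?_
        refine (relation_freeMk ρ _ _).trans ?_
        symm
        refine (congrArg ((singularFree A Unit T).left.map θ) (relation_freeMk ρ e s)).trans ?_
        refine (map_sub_smul ((singularFree A Unit T).left.map θ) _ _ _).trans ?_
        exact congrArg₂ (fun a b => a - scalar A (ρ (FreeGroup.of e)) • b)
          (singularFree_map_freeMk θ _ _) (singularFree_map_freeMk θ _ _) }
  right := augRelation ρ
  w := by
    refine NatTrans.ext (funext fun n => ?_)
    refine ModuleCat.free_hom_ext (X := ι × C(stdSimplex ℝ (Fin (n.unop.len + 1)), T))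
      fun ⟨e, s⟩ => ?_
    have hε : ∀ (J : Type) (j : J) (s : C(stdSimplex ℝ (Fin (n.unop.len + 1)), T)),
        (singularFree A J T).hom.app n (ModuleCat.freeMk (j, s)) = ModuleCat.freeMk j :=
      fun J j s => ModuleCat.free_map_apply _ _
    refine (congrArg ((singularFree A Unit T).hom.app n) (relation_freeMk ρ e s)).trans ?_
    refine Eq.trans ?_ (congrArg (augRelation ρ) (hε ι e s)).symm
    rw [augRelation_freeMk, sub_smul, one_smul]
    refine (map_sub_smul ((singularFree A Unit T).hom.app n) _ _ _).trans ?_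
    exact congrArg₂ (fun a b => a - scalar A (ρ (FreeGroup.of e)) • b) (hε _ _ _) (hε _ _ _)

variable {E : Type} [TopologicalSpace E] [MulAction A E] [ContinuousConstSMul A E]

/-- `toExtend` as a map of simplicial vector spaces. -/
def singularToExtend (q : C(T, E)) : (singularFree A Unit T).left ⟶
    ((SimplicialObject.whiskering _ _).obj (extend A)).obj (singularModule A E) where
  app n := toExtend (A := A) (P := C(stdSimplex ℝ (Fin (n.unop.len + 1)), T))
    (S := SingularSimplex E n.unop) fun s => q.comp s
  naturality m n θ := by
    refine ModuleCat.free_hom_ext fun ⟨e, s⟩ => ?_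
    refine (congrArg (toExtend _) (singularFree_map_freeMk θ e s)).trans ?_
    refine (toExtend_freeMk _ _).trans ?_
    symm
    refine (congrArg ((extend A).map (freeModuleMap (singularPrecomp A E θ.unop)))
      (toExtend_freeMk _ _)).trans ?_
    exact map_gen _ _

theorem tensorQuot_singularChains : (alternatingFaceMapComplex _).obj
    (((SimplicialObject.whiskering _ _).obj (extend A)).obj (singularModule A E)) =
      (tensorQuot A).obj (singularChains A E) :=
  (Functor.congr_obj (map_alternatingFaceMapComplex (extend A)) (singularModule A E)).symm

/-- `toExtend` as a map of chain complexes. -/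
def chainsToExtend (q : C(T, E)) :
    freeChains A Unit T ⟶ (tensorQuot A).obj (singularChains A E) :=
  (alternatingFaceMapComplex _).map (singularToExtend q) ≫ eqToHom tensorQuot_singularChains

theorem chainsToExtend_f (q : C(T, E)) (n : ℕ) : (chainsToExtend (A := A) q).f n =
    toExtend (A := A) (P := C(stdSimplex ℝ (Fin (n + 1)), T))
      (S := SingularSimplex E (SimplexCategory.mk n)) fun s => q.comp s := by
  rw [chainsToExtend, HomologicalComplex.comp_f, HomologicalComplex.eqToHom_f]
  exact Category.comp_id _

theorem chainsToExtend_freeMk (q : C(T, E)) (n : ℕ) (s : C(stdSimplex ℝ (Fin (n + 1)), T)) :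
    (chainsToExtend (A := A) q).f n (ModuleCat.freeMk ((), s)) =
      gen (S := SingularSimplex E (SimplexCategory.mk n)) (q.comp s) := by
  rw [chainsToExtend_f]
  exact toExtend_freeMk _ _

end TwistedFree

namespace ContractibleCovering

open AlgebraicTopology SingularCone TwistedFree

variable {A ι T X : Type} [CommGroup A] [TopologicalSpace T] [MulAction (FreeGroup ι) T]
  [ContinuousConstSMul (FreeGroup ι) T] [TopologicalSpace X]
  (C : ContractibleCovering (FreeGroup ι) T X) (α : FundamentalGroup X (C.p C.base) →* A)

theorem postcomp_smul {Z : Type} [TopologicalSpace Z] (g : FreeGroup ι) (s : C(Z, T)) :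
    (C.toAlphaCover α).comp (g • s) = C.deckHom α g • (C.toAlphaCover α).comp s :=
  ContinuousMap.ext fun z => C.toAlphaCover_smul α g (s z)

/-- The sequence `0 → K[ι × S] → K[S] → K ⊗ ℤ[S'] → 0` of chain complexes, where `S` are the
singular simplices of `T` and `S'` those of the `α`-cover. -/
def shortComplex : ShortComplex (ChainComplex (ModuleCat.{0} (QuotGroupRing A)) ℕ) where
  X₁ := freeChains A ι T
  X₂ := freeChains A Unit T
  X₃ := (tensorQuot A).obj (singularChains A (AlphaCover α))
  f := (alternatingFaceMapComplex _).map (singularRelation (C.deckHom α) T).left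
  g := chainsToExtend (C.toAlphaCover α)
  zero := by
    ext n : 1
    rw [HomologicalComplex.comp_f, chainsToExtend_f]
    exact relation_comp_toExtend _ (C.postcomp_smul α)

theorem shortExact : (C.shortComplex α).ShortExact := by
  refine HomologicalComplex.shortExact_of_degreewise_shortExact _ fun n => ?_
  have hcancel := C.isQuotientCoveringMap.isCancelSMul
  refine { exact := ?_, mono_f := ?_, epi_g := ?_ }
  · rw [ShortComplex.moduleCat_exact_iff]
    intro x hx
    refine exact_relation_toExtend (C.deckHom α)
      (q := fun s : C(stdSimplex ℝ (Fin (n + 1)), T) => (C.toAlphaCover α).comp s)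
      (C.exists_lift α) (fun a b s s' h => ?_) x ?_
    · obtain ⟨g, h₁, h₂⟩ := C.lift_unique α h
      exact ⟨g, ContinuousMap.ext h₁, h₂⟩
    · refine Eq.trans ?_ hx
      exact congrArg (fun k => k.hom x) (chainsToExtend_f (C.toAlphaCover α) n).symm
  · refine (ModuleCat.mono_iff_injective _).2 (relation_injective (C.deckHom α) fun g s h => ?_)
    have := congrArg (fun k => k (Classical.arbitrary (stdSimplex ℝ (Fin (n + 1))))) h
    exact IsCancelSMul.right_cancel _ _ _ (this.trans (one_smul _ _).symm)
  · refine (ModuleCat.epi_iff_surjective _).2 ?_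
    have h := toExtend_surjective (A := A)
      (q := fun s : C(stdSimplex ℝ (Fin (n + 1)), T) => (C.toAlphaCover α).comp s)
      (C.exists_lift α)
    rw [← chainsToExtend_f] at h
    exact h

end ContractibleCovering

/-! ### The map between the augmentations -/

namespace TwistedFree

variable {A : Type} [CommGroup A]

theorem scalar_injective : Function.Injective (scalar A) :=
  (IsFractionRing.injective (MonoidAlgebra ℤ A) (QuotGroupRing A)).comp MonoidAlgebra.of_injective

theorem augRelation_one {ι : Type} : augRelation (1 : FreeGroup ι →* A) = 0 := by
  refine ModuleCat.free_hom_ext fun e => ?_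
  rw [augRelation_freeMk, MonoidHom.one_apply, map_one, sub_self, zero_smul]
  rfl

theorem smul_single_unit {K : Type*} [Semiring K] (x : Unit →₀ K) :
    x () • Finsupp.single () 1 = x := by
  ext
  simp

theorem augRelation_surjective [IsDomain (MonoidAlgebra ℤ A)] {ι : Type} {ρ : FreeGroup ι →* A}
    (hρ : ρ ≠ 1) : Function.Surjective (augRelation ρ).hom := by
  obtain ⟨e, he⟩ : ∃ e, ρ (FreeGroup.of e) ≠ 1 := by
    contrapose! hρ
    exact FreeGroup.ext_hom _ _ hρ
  have hk : 1 - scalar A (ρ (FreeGroup.of e)) ≠ 0 := fun h =>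
    he (scalar_injective ((sub_eq_zero.1 h).symm.trans (map_one _).symm))
  intro (x : Unit →₀ QuotGroupRing A)
  refine ⟨(x () * (1 - scalar A (ρ (FreeGroup.of e)))⁻¹) • ModuleCat.freeMk e, ?_⟩
  rw [map_smul]
  refine (congrArg _ (augRelation_freeMk ρ e)).trans ?_
  rw [← mul_smul, mul_assoc, inv_mul_cancel₀ hk, mul_one]
  exact smul_single_unit x

theorem finrank_ker_add_one {K : Type*} [Field K] {J : Type*} [Fintype J]
    {f : (J →₀ K) →ₗ[K] (Unit →₀ K)} (hf : Function.Surjective f) :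
    Module.finrank K (LinearMap.ker f) + 1 = Fintype.card J := by
  have h := LinearMap.finrank_range_add_finrank_ker f
  rwa [LinearMap.range_eq_top.2 hf, finrank_top, Module.finrank_finsupp_self,
    Module.finrank_finsupp_self, Fintype.card_unit, add_comm] at h

end TwistedFree

/-! ### The end of the long exact homology sequence

The homology in degree `0` of the first two complexes of a short exact sequence is replaced by
isomorphic objects `M` and `N`. -/

namespace CategoryTheory.ShortComplex.ShortExact

open Limits

variable {V : Type*} [Category V] [Abelian V] {S : ShortComplex (ChainComplex V ℕ)}
  (hS : S.ShortExact) {M N : V} (a : S.X₁.homology 0 ≅ M) (b : S.X₂.homology 0 ≅ N) (r : M ⟶ N)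
  (e : HomologicalComplex.homologyMap S.f 0 ≫ b.hom = a.hom ≫ r)

include hS in
theorem isZero_homology_add_one {i : ℕ} (h₁ : IsZero (S.X₁.homology i))
    (h₂ : IsZero (S.X₂.homology (i + 1))) : IsZero (S.X₃.homology (i + 1)) :=
  (hS.homology_exact₃ (i + 1) i (by simp)).isZero_of_both_zeros (h₂.eq_of_src _ _)
    (h₁.eq_of_tgt _ _)

include hS e in
theorem isZero_homology_zero [Epi r] : IsZero (S.X₃.homology 0) := by
  have hg : Epi (HomologicalComplex.homologyMap S.g 0) := by
    have := hS.epi_g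
    exact HomologicalComplex.epi_homologyMap_of_epi_of_not_rel _ _ (by simp)
  have hf : Epi (HomologicalComplex.homologyMap S.f 0) := by
    rw [(Iso.eq_comp_inv b).2 e]
    infer_instance
  refine IsZero.of_epi_eq_zero (HomologicalComplex.homologyMap S.g 0) ?_
  rw [← cancel_epi (HomologicalComplex.homologyMap S.f 0), comp_zero,
    ← HomologicalComplex.homologyMap_comp, S.zero, HomologicalComplex.homologyMap_zero]

theorem mono_δ_comp (h₂ : IsZero (S.X₂.homology 1)) : Mono (hS.δ 1 0 (by simp) ≫ a.hom) := by
  have := hS.mono_δ 1 0 (by simp) h₂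
  infer_instance

include e in
theorem δ_comp_comp : (hS.δ 1 0 (by simp) ≫ a.hom) ≫ r = 0 := by
  rw [Category.assoc, ← e, hS.δ_comp_assoc, zero_comp]

theorem exact_δ_comp : (ShortComplex.mk _ _ (hS.δ_comp_comp a b r e)).Exact :=
  ShortComplex.exact_of_iso (S₁ := ShortComplex.mk _ _ (hS.δ_comp 1 0 (by simp)))
    (ShortComplex.isoMk (Iso.refl _) a b (Category.id_comp _) e.symm)
    (hS.homology_exact₁ 1 0 (by simp))

end CategoryTheory.ShortComplex.ShortExact

/-! ### Twisted homology of a space with a contractible covering -/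

namespace ContractibleCovering

open AlgebraicTopology SingularCone TwistedFree Limits

section Acyclic

variable {A G T X : Type} [CommGroup A] [Group G] [TopologicalSpace T] [MulAction G T]
  [TopologicalSpace X] (C : ContractibleCovering G T X)

include C in
theorem quasiIso_augmentation (J : Type) :
    QuasiIso (AlternatingFaceMapComplex.ε.app (singularFree A J T)) :=
  ((extraDegeneracy C J).map (ModuleCat.free (QuotGroupRing A))).homotopyEquiv.quasiIso_hom

include C in
theorem isZero_homology_freeChains (J : Type) {i : ℕ} (hi : i ≠ 0) :
    IsZero ((freeChains A J T).homology i) := by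
  have := C.quasiIso_augmentation (A := A) J
  refine IsZero.of_iso (HomologicalComplex.isZero_single_obj_homology _ 0 _ i hi)
    (isoOfQuasiIsoAt (AlternatingFaceMapComplex.ε.app (singularFree A J T)) i)

variable (A T) in
/-- The map from the homology in degree `0` that the augmentation induces. -/
def homologyZeroMap (J : Type) : (freeChains A J T).homology 0 ⟶
    (ModuleCat.free (QuotGroupRing A)).obj J :=
  HomologicalComplex.homologyMap (AlternatingFaceMapComplex.ε.app (singularFree A J T)) 0 ≫
    (HomologicalComplex.singleObjHomologySelfIso (ComplexShape.down ℕ) 0 _).hom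

variable (A) in
/-- The homology in degree `0` is generated by the copies of the singular set. -/
def homologyZeroIso (J : Type) : (freeChains A J T).homology 0 ≅
    (ModuleCat.free (QuotGroupRing A)).obj J :=
  have : IsIso (homologyZeroMap A T J) := by
    have := C.quasiIso_augmentation (A := A) J
    exact IsIso.comp_isIso' inferInstance (Iso.isIso_hom _)
  asIso (homologyZeroMap A T J)

theorem homologyMap_comp_single {V : Type*} [Category V] [Abelian V] {K L : ChainComplex V ℕ}
    {M N : V} (φ : K ⟶ L) (f : M ⟶ N) (a : K ⟶ (ChainComplex.single₀ V).obj M)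
    (b : L ⟶ (ChainComplex.single₀ V).obj N) (h : φ ≫ b = a ≫ (ChainComplex.single₀ V).map f) :
    HomologicalComplex.homologyMap φ 0 ≫ HomologicalComplex.homologyMap b 0 ≫
      (HomologicalComplex.singleObjHomologySelfIso (ComplexShape.down ℕ) 0 N).hom =
    (HomologicalComplex.homologyMap a 0 ≫
      (HomologicalComplex.singleObjHomologySelfIso (ComplexShape.down ℕ) 0 M).hom) ≫ f := by
  have h' := congrArg (fun k => HomologicalComplex.homologyMap k 0) h
  simp only [HomologicalComplex.homologyMap_comp] at h'
  rw [Category.assoc, ← HomologicalComplex.singleObjHomologySelfIso_hom_naturality,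
    ← Category.assoc, h', Category.assoc]

theorem homologyZeroMap_naturality {T' J J' : Type} [TopologicalSpace T']
    (F : singularFree A J T ⟶ singularFree A J' T') :
    HomologicalComplex.homologyMap ((alternatingFaceMapComplex _).map F.left) 0 ≫
      homologyZeroMap A T' J' = homologyZeroMap A T J ≫ F.right :=
  homologyMap_comp_single _ _ _ _ (AlternatingFaceMapComplex.ε.naturality F)

end Acyclic

variable {A ι T X : Type} [CommGroup A] [TopologicalSpace T] [MulAction (FreeGroup ι) T]
  [ContinuousConstSMul (FreeGroup ι) T] [TopologicalSpace X]
  (C : ContractibleCovering (FreeGroup ι) T X) (α : FundamentalGroup X (C.p C.base) →* A)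

theorem isZero_twistedHomology {i : ℕ} (hi : 2 ≤ i) : IsZero (twistedHomology α i) := by
  obtain ⟨j, rfl⟩ : ∃ j, i = j + 1 := ⟨i - 1, by omega⟩
  exact (C.shortExact α).isZero_homology_add_one (C.isZero_homology_freeChains ι (by omega))
    (C.isZero_homology_freeChains Unit (by omega))

theorem homologyMap_comp_homologyZeroMap :
    HomologicalComplex.homologyMap (C.shortComplex α).f 0 ≫ homologyZeroMap A T Unit =
      homologyZeroMap A T ι ≫ augRelation (C.deckHom α) :=
  homologyZeroMap_naturality (singularRelation (C.deckHom α) T)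

theorem isZero_twistedHomology_zero [IsDomain (MonoidAlgebra ℤ A)] (hα : α ≠ 1) :
    IsZero (twistedHomology α 0) :=
  have : Epi (augRelation (C.deckHom α)) :=
    (ModuleCat.epi_iff_surjective _).2 (augRelation_surjective (C.deckHom_ne_one α hα))
  (C.shortExact α).isZero_homology_zero (C.homologyZeroIso A ι) (C.homologyZeroIso A Unit) _
    (C.homologyMap_comp_homologyZeroMap α)

/-- The embedding of the first twisted homology group into the vector space generated by `ι`. -/
def connecting : twistedHomology α 1 ⟶ (ModuleCat.free (QuotGroupRing A)).obj ι :=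
  (C.shortExact α).δ 1 0 (by simp) ≫ homologyZeroMap A T ι

theorem mono_connecting : Mono (C.connecting α) :=
  (C.shortExact α).mono_δ_comp (C.homologyZeroIso A ι)
    (C.isZero_homology_freeChains Unit one_ne_zero)

theorem connecting_comp_augRelation : C.connecting α ≫ augRelation (C.deckHom α) = 0 :=
  (C.shortExact α).δ_comp_comp (C.homologyZeroIso A ι) (C.homologyZeroIso A Unit) _
    (C.homologyMap_comp_homologyZeroMap α)

theorem exact_connecting :
    (ShortComplex.mk _ _ (C.connecting_comp_augRelation α)).Exact :=
  (C.shortExact α).exact_δ_comp (C.homologyZeroIso A ι) (C.homologyZeroIso A Unit) _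
    (C.homologyMap_comp_homologyZeroMap α)

theorem finrank_twistedHomology [IsDomain (MonoidAlgebra ℤ A)] [Fintype ι] (hα : α ≠ 1) :
    Module.finrank (QuotGroupRing A) (twistedHomology α 1) + 1 = Fintype.card ι := by
  rw [← finrank_ker_add_one (K := QuotGroupRing A) (J := ι)
    (augRelation_surjective (C.deckHom_ne_one α hα))]
  congr 1
  have h := (C.exact_connecting α).moduleCat_range_eq_ker
  exact ((LinearEquiv.ofInjective (C.connecting α).hom
    ((ModuleCat.mono_iff_injective _).1 (C.mono_connecting α))).trans
      (LinearEquiv.ofEq _ _ h)).finrank_eq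

theorem isIso_connecting_one (h : C.deckHom α = 1) : IsIso (C.connecting α) := by
  have := C.mono_connecting α
  have : Epi (C.connecting α) := by
    refine (C.exact_connecting α).epi_f ?_
    change augRelation (C.deckHom α) = 0
    rw [h, augRelation_one]
  exact isIso_of_mono_of_epi _

end ContractibleCovering

/-! ### Naturality -/

namespace SingularCone

/-- The map that a map of index sets and a continuous map induce on singular sets. -/
def singularSetMap {J J' T T' : Type} [TopologicalSpace T] [TopologicalSpace T'] (j : J → J')
    (φ : C(T, T')) : singularSet J T ⟶ singularSet J' T' where
  left := { app := fun _ => ↾fun x => (j x.1, φ.comp x.2) }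
  right := ↾j

end SingularCone

namespace TwistedFree

open SingularCone

/-- The map of augmented simplicial vector spaces induced by `singularSetMap`. -/
def singularFreeMap (A : Type) [CommGroup A] {J J' T T' : Type} [TopologicalSpace T]
    [TopologicalSpace T'] (j : J → J') (φ : C(T, T')) :
    singularFree A J T ⟶ singularFree A J' T' :=
  ((SimplicialObject.Augmented.whiskering _ _).obj (ModuleCat.free (QuotGroupRing A))).map
    (singularSetMap j φ)

theorem singularFreeMap_freeMk {A : Type} [CommGroup A] {J J' T T' : Type} [TopologicalSpace T]
    [TopologicalSpace T'] (j : J → J') (φ : C(T, T')) (n : SimplexCategoryᵒᵖ) (i : J)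
    (s : C(stdSimplex ℝ (Fin (n.unop.len + 1)), T)) :
    (singularFreeMap A j φ).left.app n (ModuleCat.freeMk (i, s)) =
      ModuleCat.freeMk (j i, φ.comp s) :=
  ModuleCat.free_map_apply _ _

end TwistedFree

namespace ContractibleCovering

open AlgebraicTopology SingularCone TwistedFree Limits

variable {A ι T X κ T' X' : Type} [CommGroup A]
  [TopologicalSpace T] [MulAction (FreeGroup ι) T] [TopologicalSpace X]
  [TopologicalSpace T'] [MulAction (FreeGroup κ) T'] [TopologicalSpace X']

/-- A map of contractible coverings whose groups are free, over a given map of the bases, and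
compatible with a given map of free generators. -/
structure Hom (C : ContractibleCovering (FreeGroup ι) T X)
    (C' : ContractibleCovering (FreeGroup κ) T' X') (j : ι → κ) (f : C(X, X')) where
  /-- The map of covering spaces. -/
  map : C(T, T')
  map_base : map C.base = C'.base
  map_smul (e : ι) (x : T) : map (FreeGroup.of e • x) = FreeGroup.of (j e) • map x
  p_map (x : T) : C'.p (map x) = f (C.p x)

namespace Hom

variable {C : ContractibleCovering (FreeGroup ι) T X}
  {C' : ContractibleCovering (FreeGroup κ) T' X'} {j : ι → κ} {f : C(X, X')} (φ : Hom C C' j f)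

include φ in
theorem apply_base : f (C.p C.base) = C'.p C'.base := by rw [← φ.p_map, φ.map_base]

variable (α : FundamentalGroup X' (C'.p C'.base) →* A)

/-- The homomorphism `α ∘ π₁(f)`. -/
abbrev pullback : FundamentalGroup X (C.p C.base) →* A :=
  α.comp (FundamentalGroup.mapOfEq f φ.apply_base)

theorem map_toAlphaCover (x : T) :
    AlphaCover.map f φ.apply_base α (C.toAlphaCover (φ.pullback α) x) =
      C'.toAlphaCover α (φ.map x) := by
  rw [C'.toAlphaCover_eq α (((C.track x).map φ.map.continuous).cast φ.map_base.symm rfl)]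
  have h : ∀ t, C'.p (φ.map (C.track x t)) = f (C.p (C.track x t)) := fun t => φ.p_map _
  refine congrArg (Quotient.mk (AlphaCover.setoid α)) (Prod.ext (Subtype.ext ?_) rfl)
  exact ContinuousMap.ext fun t => (h t).symm

theorem deckHom_of (e : ι) :
    C.deckHom (φ.pullback α) (FreeGroup.of e) = C'.deckHom α (FreeGroup.of (j e)) := by
  refine AlphaCover.smul_left_injective α (C'.toAlphaCover α (φ.map C.base)) ?_
  change _ • _ = _ • _
  rw [← C'.toAlphaCover_smul, ← φ.map_smul, ← φ.map_toAlphaCover, ← φ.map_toAlphaCover,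
    C.toAlphaCover_smul, AlphaCover.map_smul]

variable [ContinuousConstSMul (FreeGroup ι) T] [ContinuousConstSMul (FreeGroup κ) T']

/-- The map of short exact sequences induced by a map of contractible coverings. -/
def shortComplexMap : C.shortComplex (φ.pullback α) ⟶ C'.shortComplex α where
  τ₁ := (alternatingFaceMapComplex _).map (singularFreeMap A j φ.map).left
  τ₂ := (alternatingFaceMapComplex _).map (singularFreeMap A id φ.map).left
  τ₃ := (tensorQuot A).map (singularChainsMap (AlphaCover.map f φ.apply_base α)
    (AlphaCover.map_smul f φ.apply_base α))
  comm₁₂ := by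
    ext n : 1
    refine ModuleCat.free_hom_ext (X := ι × C(stdSimplex ℝ (Fin (n + 1)), T)) fun ⟨e, s⟩ => ?_
    have h₁ := singularFreeMap_freeMk (A := A) j φ.map (Opposite.op (SimplexCategory.mk n)) e s
    have h₂ := singularFreeMap_freeMk (A := A) (J := Unit) id φ.map
      (Opposite.op (SimplexCategory.mk n)) ()
    refine (congrArg (relation (C'.deckHom α)) h₁).trans ?_
    refine (relation_freeMk _ _ _).trans ?_
    symm
    refine (congrArg ((singularFreeMap A id φ.map).left.app (Opposite.op (SimplexCategory.mk n)))
      (relation_freeMk (C.deckHom (φ.pullback α)) e s)).trans ?_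
    refine (map_sub_smul ((singularFreeMap A id φ.map).left.app
      (Opposite.op (SimplexCategory.mk n))) _ _ _).trans ?_
    rw [φ.deckHom_of]
    refine congrArg₂ (fun a b => a - scalar A (C'.deckHom α (FreeGroup.of (j e))) • b)
      ((h₂ _).trans (congrArg (fun z => ModuleCat.freeMk ((), z)) ?_)) (h₂ _)
    exact ContinuousMap.ext fun z => φ.map_smul e (s z)
  comm₂₃ := by
    ext n : 1
    refine ModuleCat.free_hom_ext (X := Unit × C(stdSimplex ℝ (Fin (n + 1)), T)) fun ⟨_, s⟩ => ?_
    have h₂ := singularFreeMap_freeMk (A := A) (J := Unit) id φ.map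
      (Opposite.op (SimplexCategory.mk n)) () s
    refine (congrArg ((chainsToExtend (C'.toAlphaCover α)).f n) h₂).trans ?_
    refine (chainsToExtend_freeMk (A := A) (C'.toAlphaCover α) n _).trans ?_
    symm
    refine (congrArg (((tensorQuot A).map (singularChainsMap (A := A) (AlphaCover.map f φ.apply_base α)
      (AlphaCover.map_smul f φ.apply_base α))).f n) 
        (chainsToExtend_freeMk (A := A) (C.toAlphaCover (φ.pullback α)) n s)).trans ?_
    refine (map_gen (singularPostcomp (AlphaCover.map f φ.apply_base α)
      (AlphaCover.map_smul f φ.apply_base α) (SimplexCategory.mk n)) _).trans (congrArg gen ?_)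
    exact ContinuousMap.ext fun z => φ.map_toAlphaCover α (s z)

theorem connecting_naturality : C.connecting (φ.pullback α) ≫ (ModuleCat.free _).map (↾j) =
    twistedHomologyMap f φ.apply_base α 1 ≫ C'.connecting α := by
  have h₁ := HomologicalComplex.HomologySequence.δ_naturality (φ.shortComplexMap α) (C.shortExact _)
    (C'.shortExact α) 1 0 (by simp)
  have h₂ := homologyZeroMap_naturality (singularFreeMap A j φ.map)
  refine (Category.assoc _ _ _).trans ?_
  refine (congrArg (_ ≫ ·) h₂.symm).trans ?_
  refine (Category.assoc _ _ _).symm.trans ?_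
  refine (congrArg (· ≫ _) h₁).trans ?_
  exact Category.assoc _ _ _

theorem surjective_of_finrank {K V W ι κ : Type*} [Field K] [AddCommGroup V] [Module K V]
    [AddCommGroup W] [Module K W] [Fintype ι] [Fintype κ] (c : V ≃ₗ[K] (ι →₀ K))
    {d : W →ₗ[K] (κ →₀ K)} (hd : Function.Injective d) {m : V →ₗ[K] W} (hm : Function.Injective m)
    (hW : Module.finrank K W = Fintype.card ι) : Function.Surjective m := by
  have : FiniteDimensional K W := Module.Finite.of_injective d hd
  have : FiniteDimensional K V := Module.Finite.equiv c.symm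
  refine (LinearMap.injective_iff_surjective_of_finrank_eq_finrank ?_).1 hm
  rw [hW, c.finrank_eq, Module.finrank_finsupp_self]

/-- A map of coverings for which the number of generators increases by one induces an isomorphism
in degree `1` if `α` is nontrivial, but its restriction is trivial: both sides embed into the vector
spaces generated by `ι` and `κ`, the first one as the whole space and the second one as a
hyperplane. -/
theorem isIso_twistedHomologyMap [IsDomain (MonoidAlgebra ℤ A)] [Fintype ι] [Fintype κ]
    (hj : Function.Injective j) (hcard : Fintype.card κ = Fintype.card ι + 1) (hα : α ≠ 1)
    (hpull : φ.pullback α = 1) : IsIso (twistedHomologyMap f φ.apply_base α 1) := by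
  have hdeck : C.deckHom (φ.pullback α) = 1 := by
    rw [hpull]
    rfl
  have := C.isIso_connecting_one (φ.pullback α) hdeck
  have hfree : Mono ((ModuleCat.free (QuotGroupRing A)).map (↾j)) :=
    (ModuleCat.mono_iff_injective _).2 (Finsupp.mapDomain_injective (M := QuotGroupRing A) hj)
  have hmono : Mono (twistedHomologyMap f φ.apply_base α 1) := by
    have := mono_comp (C.connecting (φ.pullback α)) ((ModuleCat.free (QuotGroupRing A)).map (↾j))
    exact mono_of_mono_fac (φ.connecting_naturality α).symm
  have : Epi (twistedHomologyMap f φ.apply_base α 1) := by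
    refine (ModuleCat.epi_iff_surjective _).2 ?_
    refine surjective_of_finrank (K := QuotGroupRing A) (ι := ι) (κ := κ)
      (asIso (C.connecting (φ.pullback α))).toLinearEquiv (d := (C'.connecting α).hom)
      ((ModuleCat.mono_iff_injective _).1 (C'.mono_connecting α))
      ((ModuleCat.mono_iff_injective _).1 hmono) ?_
    have := C'.finrank_twistedHomology α hα
    omega
  exact isIso_of_mono_of_epi _

end Hom

end ContractibleCovering

/-! ### Maps of Cayley trees -/

namespace CayleyTree

variable {ι κ : Type} {j : ι → κ}

/-- Extension by zero of functions on edges along an injective map of free generators. -/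
def extendEdges (j : ι → κ) (f : EdgeSpace ι) : EdgeSpace κ :=
  Function.extend (Prod.map (FreeGroup.map j) j) f 0

theorem prodMap_injective (hj : Function.Injective j) :
    Function.Injective (Prod.map (FreeGroup.map j) j) :=
  (FreeGroup.map_injective hj).prodMap hj

theorem extendEdges_apply (hj : Function.Injective j) (f : EdgeSpace ι) (x : FreeGroup ι × ι) :
    extendEdges j f (FreeGroup.map j x.1, j x.2) = f x :=
  (prodMap_injective hj).extend_apply f 0 x

theorem extendEdges_apply_of_notMem (f : EdgeSpace ι) {y : FreeGroup κ × κ}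
    (hy : y ∉ Set.range (Prod.map (FreeGroup.map j) j)) : extendEdges j f y = 0 :=
  Function.extend_apply' _ _ _ hy

theorem continuous_extendEdges (hj : Function.Injective j) : Continuous (extendEdges j) := by
  refine continuous_pi fun y => ?_
  by_cases hy : y ∈ Set.range (Prod.map (FreeGroup.map j) j)
  · obtain ⟨x, rfl⟩ := hy
    exact (continuous_apply x).congr fun f => (extendEdges_apply hj f x).symm
  · exact continuous_const.congr fun f => (extendEdges_apply_of_notMem f hy).symm

variable [DecidableEq ι] [DecidableEq κ]

theorem extendEdges_single (hj : Function.Injective j) (x : FreeGroup ι × ι) (t : ℝ) :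
    extendEdges j (Pi.single x t : EdgeSpace ι) =
      (Pi.single (FreeGroup.map j x.1, j x.2) t : EdgeSpace κ) := by
  ext y
  by_cases hy : y ∈ Set.range (Prod.map (FreeGroup.map j) j)
  · obtain ⟨z, rfl⟩ := hy
    refine (extendEdges_apply hj _ z).trans ?_
    simp only [Pi.single_apply]
    exact if_congr (prodMap_injective hj).eq_iff.symm rfl rfl
  · rw [extendEdges_apply_of_notMem _ hy, Pi.single_eq_of_ne]
    rintro rfl
    exact hy ⟨x, rfl⟩

theorem extendEdges_of_smul (hj : Function.Injective j) (a : ι) (f : EdgeSpace ι) :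
    extendEdges j (FreeGroup.of a • f) = FreeGroup.of (j a) • extendEdges j f := by
  ext y
  rw [of_smul_apply, ← map_one (FreeGroup.map j), ← extendEdges_single hj (1, a)]
  by_cases hy : y ∈ Set.range (Prod.map (FreeGroup.map j) j)
  · obtain ⟨x, rfl⟩ := hy
    have h : (FreeGroup.of (j a))⁻¹ * FreeGroup.map j x.1 =
        FreeGroup.map j ((FreeGroup.of a)⁻¹ * x.1) := by simp
    simp only [Prod.map_apply']
    rw [h, extendEdges_apply hj f ((FreeGroup.of a)⁻¹ * x.1, x.2)]
    exact (extendEdges_apply hj _ x).trans ((of_smul_apply a f x).trans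
      (congrArg (· + _) (extendEdges_apply hj _ x).symm))
  · rw [extendEdges_apply_of_notMem _ hy, extendEdges_apply_of_notMem _ hy,
      extendEdges_apply_of_notMem, add_zero]
    rintro ⟨x, hx⟩
    obtain ⟨h₁, h₂⟩ := Prod.ext_iff.1 hx
    refine hy ⟨(FreeGroup.of a * x.1, x.2), Prod.ext ?_ h₂⟩
    simp only [Prod.map_fst] at h₁ ⊢
    simp [h₁]

theorem extendEdges_smul (hj : Function.Injective j) (g : FreeGroup ι) (f : EdgeSpace ι) :
    extendEdges j (g • f) = FreeGroup.map j g • extendEdges j f := by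
  induction g using FreeGroup.induction_on generalizing f with
  | C1 => rw [one_smul, map_one, one_smul]
  | of a => rw [extendEdges_of_smul hj, FreeGroup.map.of]
  | inv_of a h => rw [map_inv, eq_inv_smul_iff, ← h, smul_inv_smul]
  | mul g h hg hh => rw [mul_smul, hg, hh, map_mul, mul_smul]

theorem extendEdges_edgePoint (hj : Function.Injective j) (g : FreeGroup ι) (e : ι) (t : ℝ) :
    extendEdges j (edgePoint g e t) = edgePoint (FreeGroup.map j g) (j e) t := by
  rw [edgePoint, extendEdges_smul hj, extendEdges_single hj, map_one, edgePoint]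

theorem extendEdges_mem (hj : Function.Injective j) {f : EdgeSpace ι} (hf : f ∈ carrier ι) :
    extendEdges j f ∈ carrier κ := by
  obtain ⟨g, e, t, ht, rfl⟩ := hf
  exact ⟨FreeGroup.map j g, j e, t, ht, extendEdges_edgePoint hj g e t⟩

/-- The embedding of Cayley trees that an injective map of free generators induces. -/
def mapTree (hj : Function.Injective j) : C(CayleyTree ι, CayleyTree κ) where
  toFun x := ⟨extendEdges j x.1, extendEdges_mem hj x.2⟩
  continuous_toFun := ((continuous_extendEdges hj).comp continuous_subtype_val).subtype_mk _

theorem mapTree_ofEdges (hj : Function.Injective j) (g : FreeGroup ι) (e : ι) (t : I) :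
    mapTree hj (ofEdges ⟨(g, e), t⟩) = ofEdges ⟨(FreeGroup.map j g, j e), t⟩ :=
  Subtype.ext (extendEdges_edgePoint hj g e t)

/-! ### The covering of a wedge of circles by a tree -/

variable {X X' : Type} [Nonempty ι] [Fintype ι] [TopologicalSpace ι] [DiscreteTopology ι]
  [TopologicalSpace X] [Nonempty κ] [Fintype κ] [TopologicalSpace κ] [DiscreteTopology κ]
  [TopologicalSpace X'] {c : C(ι × I, X)} {c' : C(κ × I, X')}

/-- The Cayley tree as a contractible covering of a wedge of circles. -/
def covering (hc : IsRose c) : ContractibleCovering (FreeGroup ι) (CayleyTree ι) X where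
  p := proj hc
  isQuotientCoveringMap := isQuotientCoveringMap_proj hc
  base := root
  contraction := homotopy
  contraction_zero := homotopy_zero
  contraction_one := homotopy_one

theorem covering_p_base (hc : IsRose c) (e : ι) :
    (covering hc).p (covering hc).base = c (e, 0) := proj_root hc e

/-- The map of coverings over the inclusion of some of the circles of a wedge. -/
def coveringHom (hc : IsRose c) (hc' : IsRose c') (hj : Function.Injective j) (f : C(X, X'))
    (hf : ∀ e t, f (c (e, t)) = c' (j e, t)) :
    ContractibleCovering.Hom (covering hc) (covering hc') j f where
  map := mapTree hj
  map_base := by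
    change mapTree hj root = root
    rw [root_eq (Classical.arbitrary ι), mapTree_ofEdges, map_one, ← root_eq]
  map_smul e x := Subtype.ext (extendEdges_of_smul hj e x.1)
  p_map x := by
    obtain ⟨⟨⟨g, e⟩, t⟩, rfl⟩ := ofEdges_surjective x
    change proj hc' (mapTree hj _) = f (proj hc _)
    rw [mapTree_ofEdges, proj_ofEdges, proj_ofEdges, hf]

end CayleyTree

/-! ### The circle and the wedge of two circles -/

/-- The parametrization of the circle by the unit interval. -/
def circleParam (t : I) : Circle := Circle.exp (2 * Real.pi * t)

theorem continuous_circleParam : Continuous circleParam := by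
  unfold circleParam
  fun_prop

theorem circleParam_zero : circleParam 0 = 1 := by simp [circleParam]

theorem circleParam_eq_iff (s t : I) :
    circleParam s = circleParam t ↔ s = t ∨ ((s = 0 ∨ s = 1) ∧ (t = 0 ∨ t = 1)) := by
  have h0 := s.2.1
  have h1 := s.2.2
  have h2 := t.2.1
  have h3 := t.2.2
  have hπ := Real.two_pi_pos
  rw [circleParam, circleParam, Circle.exp_eq_exp]
  constructor
  · rintro ⟨m, hm⟩
    have hm' : (s : ℝ) = t + m := by
      refine mul_left_cancel₀ hπ.ne' ?_
      linarith
    have l : (-2 : ℝ) < m := by linarith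
    have u : (m : ℝ) < 2 := by linarith
    have l' : -2 < m := by exact_mod_cast l
    have u' : m < 2 := by exact_mod_cast u
    obtain rfl | rfl | rfl : m = -1 ∨ m = 0 ∨ m = 1 := by omega
    · push_cast at hm'
      exact Or.inr ⟨Or.inl (Subtype.ext (by change (s : ℝ) = 0; linarith)),
        Or.inr (Subtype.ext (by change (t : ℝ) = 1; linarith))⟩
    · exact Or.inl (Subtype.ext (by simpa using hm'))
    · push_cast at hm'
      exact Or.inr ⟨Or.inr (Subtype.ext (by change (s : ℝ) = 1; linarith)),
        Or.inl (Subtype.ext (by change (t : ℝ) = 0; linarith))⟩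
  · rintro (rfl | ⟨rfl | rfl, rfl | rfl⟩)
    · exact ⟨0, by simp⟩
    · exact ⟨0, by simp⟩
    · exact ⟨-1, by simp⟩
    · exact ⟨1, by simp⟩
    · exact ⟨0, by simp⟩

theorem circleParam_eq_one {t : I} : circleParam t = 1 ↔ t = 0 ∨ t = 1 := by
  rw [← circleParam_zero, circleParam_eq_iff]
  simp

theorem circleParam_surjective : Function.Surjective circleParam := by
  intro z
  obtain ⟨x, rfl⟩ := Circle.exp_surjective z
  obtain ⟨y, hy, hxy⟩ := Circle.periodic_exp.exists_mem_Ico₀ Real.two_pi_pos x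
  have hπ := Real.two_pi_pos
  refine ⟨⟨y / (2 * Real.pi), div_nonneg hy.1 hπ.le, (div_le_one hπ).2 hy.2.le⟩, ?_⟩
  rw [hxy, circleParam]
  congr 1
  exact mul_div_cancel₀ y hπ.ne'

/-- The circle as a wedge of one circle. -/
def circleRose : C(Unit × I, Circle) := ⟨fun x => circleParam x.2,
  continuous_circleParam.comp continuous_snd⟩

theorem isRose_circleRose : IsRose circleRose where
  isQuotientMap := circleRose.continuous.isClosedMap.isQuotientMap circleRose.continuous fun z => by
    obtain ⟨t, rfl⟩ := circleParam_surjective z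
    exact ⟨((), t), rfl⟩
  apply_eq_iff x y := by
    refine (circleParam_eq_iff x.2 y.2).trans (or_congr_left ?_)
    exact ⟨fun h => Prod.ext rfl h, fun h => congrArg Prod.snd h⟩

namespace CircleWedge

/-- The retraction to the first circle. -/
def retract₁ : CircleWedge → Circle :=
  Quot.lift (Sum.elim id 1) (by rintro _ _ ⟨rfl, rfl⟩; rfl)

/-- The retraction to the second circle. -/
def retract₂ : CircleWedge → Circle :=
  Quot.lift (Sum.elim 1 id) (by rintro _ _ ⟨rfl, rfl⟩; rfl)

theorem incl₁_eq_incl₂_iff (z w : Circle) : incl₁ z = incl₂ w ↔ z = 1 ∧ w = 1 := by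
  constructor
  · intro h
    exact ⟨congrArg retract₁ h, (congrArg retract₂ h).symm⟩
  · rintro ⟨rfl, rfl⟩
    exact incl₁_one.trans incl₂_one.symm

theorem incl₁_injective : Function.Injective incl₁ := fun _ _ h => congrArg retract₁ h

theorem incl₂_injective : Function.Injective incl₂ := fun _ _ h => congrArg retract₂ h

/-- The parametrization of `S¹ ⊕ S¹` by two unit intervals. -/
def sumParam (x : Bool × I) : Circle ⊕ Circle :=
  bif x.1 then Sum.inr (circleParam x.2) else Sum.inl (circleParam x.2)

theorem continuous_sumParam : Continuous sumParam := by
  rw [continuous_prod_of_discrete_left]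
  rintro (_ | _)
  · exact continuous_inl.comp continuous_circleParam
  · exact continuous_inr.comp continuous_circleParam

/-- The wedge of two circles as a quotient of two unit intervals. -/
def rose : C(Bool × I, CircleWedge) :=
  ⟨fun x => Quot.mk _ (sumParam x), continuous_quot_mk.comp continuous_sumParam⟩

theorem isRose_rose : IsRose rose where
  isQuotientMap := by
    refine isQuotientMap_quot_mk.comp
      (continuous_sumParam.isClosedMap.isQuotientMap continuous_sumParam ?_)
    rintro (z | z) <;> obtain ⟨t, rfl⟩ := circleParam_surjective z
    · exact ⟨(false, t), rfl⟩
    · exact ⟨(true, t), rfl⟩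
  apply_eq_iff := by
    rintro ⟨_ | _, s⟩ ⟨_ | _, t⟩
    · refine (incl₁_injective.eq_iff (a := circleParam s) (b := circleParam t)).trans ?_
      rw [circleParam_eq_iff]
      simp
    · refine (incl₁_eq_incl₂_iff (circleParam s) (circleParam t)).trans ?_
      rw [circleParam_eq_one, circleParam_eq_one]
      simp
    · refine eq_comm.trans ((incl₁_eq_incl₂_iff (circleParam t) (circleParam s)).trans ?_)
      rw [circleParam_eq_one, circleParam_eq_one]
      simp [and_comm]
    · refine (incl₂_injective.eq_iff (a := circleParam s) (b := circleParam t)).trans ?_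
      rw [circleParam_eq_iff]
      simp

end CircleWedge

theorem isDomain_monoidAlgebra {n : ℕ} {A : Type} [CommGroup A]
    (e : A ≃* Multiplicative (Fin n → ℤ)) : IsDomain (MonoidAlgebra ℤ A) := by
  have : UniqueProds A := e.uniqueProds_iff.2 inferInstance
  exact NoZeroDivisors.to_isDomain _

/-! ### Twisted homology of wedges of circles -/

namespace IsRose

variable {A ι X : Type} [CommGroup A] [IsDomain (MonoidAlgebra ℤ A)] [DecidableEq ι] [Nonempty ι]
  [Fintype ι] [TopologicalSpace ι] [DiscreteTopology ι] [TopologicalSpace X] {c : C(ι × I, X)}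
  (hc : IsRose c) {x₀ : X} (hx : ∀ e, c (e, 0) = x₀) (α : FundamentalGroup X x₀ →* A) (hα : α ≠ 1)

include hc hx hα

theorem isZero_twistedHomology {i : ℕ} (hi : i ≠ 1) : Limits.IsZero (twistedHomology α i) := by
  obtain rfl := (CayleyTree.covering_p_base hc (Classical.arbitrary ι)).trans (hx _)
  obtain rfl | hi' : i = 0 ∨ 2 ≤ i := by omega
  · exact (CayleyTree.covering hc).isZero_twistedHomology_zero α hα
  · exact (CayleyTree.covering hc).isZero_twistedHomology α hi'

theorem finrank_twistedHomology :
    Module.finrank (QuotGroupRing A) (twistedHomology α 1) + 1 = Fintype.card ι := by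
  obtain rfl := (CayleyTree.covering_p_base hc (Classical.arbitrary ι)).trans (hx _)
  exact (CayleyTree.covering hc).finrank_twistedHomology α hα

end IsRose

/-- Isomorphism in degree `1` for an inclusion of wedges of circles with one more circle in the
target. -/
theorem IsRose.isIso_twistedHomologyMap {A ι κ X X' : Type} [CommGroup A]
    [IsDomain (MonoidAlgebra ℤ A)] [DecidableEq ι] [Nonempty ι] [Fintype ι] [TopologicalSpace ι]
    [DiscreteTopology ι] [TopologicalSpace X] [DecidableEq κ] [Nonempty κ] [Fintype κ]
    [TopologicalSpace κ] [DiscreteTopology κ] [TopologicalSpace X'] {c : C(ι × I, X)}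
    {c' : C(κ × I, X')} (hc : IsRose c) (hc' : IsRose c') {j : ι → κ} (hj : Function.Injective j)
    (hcard : Fintype.card κ = Fintype.card ι + 1) (f : C(X, X'))
    (hf : ∀ e t, f (c (e, t)) = c' (j e, t)) {x₀ : X} {y₀ : X'} (hx : ∀ e, c (e, 0) = x₀)
    (hy : ∀ e, c' (e, 0) = y₀) (hxy : f x₀ = y₀) (α : FundamentalGroup X' y₀ →* A) (hα : α ≠ 1)
    (hpull : α.comp (FundamentalGroup.mapOfEq f hxy) = 1) :
    IsIso (twistedHomologyMap f hxy α 1) := by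
  obtain rfl := (CayleyTree.covering_p_base hc (Classical.arbitrary ι)).trans (hx _)
  obtain rfl := (CayleyTree.covering_p_base hc' (Classical.arbitrary κ)).trans (hy _)
  exact (CayleyTree.coveringHom hc hc' hj f hf).isIso_twistedHomologyMap α hj hcard hα hpull

theorem CircleWedge.rose_zero (e : Bool) : rose (e, 0) = base := by
  cases e
  · exact congrArg incl₁ circleParam_zero
  · exact (congrArg incl₂ circleParam_zero).trans incl₂_one

end

/-- The twisted homology of `S¹ ∨ S¹` for a nontrivial homomorphism `α` to a group `A ≅ ℤⁿ`. -/
theorem theorem2p2 (n : ℕ) (A : Type) [CommGroup A] (hA : Nonempty (A ≃* Multiplicative (Fin n → ℤ)))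
    (α : FundamentalGroup CircleWedge CircleWedge.base →* A) (hα : α ≠ 1) :
    Nonempty (twistedHomology α 1 ≅ ModuleCat.of (QuotGroupRing A) (QuotGroupRing A)) ∧
    (∀ i : ℕ, i ≠ 1 → CategoryTheory.Limits.IsZero (twistedHomology α i)) ∧
    (α.comp (FundamentalGroup.mapOfEq CircleWedge.incl₁ CircleWedge.incl₁_one) = 1 →
      CategoryTheory.IsIso
        (twistedHomologyMap CircleWedge.incl₁ CircleWedge.incl₁_one α 1)) ∧
    (α.comp (FundamentalGroup.mapOfEq CircleWedge.incl₂ CircleWedge.incl₂_one) = 1 →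
      CategoryTheory.IsIso
        (twistedHomologyMap CircleWedge.incl₂ CircleWedge.incl₂_one α 1)) := by
  obtain ⟨e⟩ := hA
  have := isDomain_monoidAlgebra e
  refine ⟨?_, ?_, fun h => ?_, fun h => ?_⟩
  · have h := CircleWedge.isRose_rose.finrank_twistedHomology CircleWedge.rose_zero α hα
    rw [Fintype.card_bool] at h
    obtain ⟨ψ⟩ := Module.nonempty_linearEquiv_of_finrank_eq_one (R := QuotGroupRing A)
      (M := twistedHomology α 1) (by omega)
    exact ⟨ψ.symm.toModuleIso⟩
  · exact fun i => CircleWedge.isRose_rose.isZero_twistedHomology CircleWedge.rose_zero α hα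
  · exact isRose_circleRose.isIso_twistedHomologyMap CircleWedge.isRose_rose (j := fun _ => false)
      (fun _ _ _ => rfl) (by simp) _ (fun _ _ => rfl)
      (fun _ => circleParam_zero) CircleWedge.rose_zero _ α hα h
  · exact isRose_circleRose.isIso_twistedHomologyMap CircleWedge.isRose_rose (j := fun _ => true)
      (fun _ _ _ => rfl) (by simp) _ (fun _ _ => rfl)
      (fun _ => circleParam_zero) CircleWedge.rose_zero _ α hα h
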